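/- All algebras are over $\mathbb{C}$. A Leibniz algebra is a vector space $L$ with a bilinear bracket satisfying $[x,[y,z]]=[[x,y],z]-[[x,z],y]$. Put $L^1=L$, $L^{k+1}=[L^k,L]$; $L$ is nilpotent if $L^s=0$ for some $s$, and a nilpotent $L$ is naturally graded if it is isomorphic to $\operatorname{gr}L=\bigoplus_{i\ge1}L^i/L^{i+1}$ with the induced bracket. Let $R_x\colon y\mapsto[y,x]$ and $R(L)=\{x\in L:[y,x]=0\text{ for all }y\in L\}$. The characteristic sequence of $L$ is the lexicographic maximum, over $x\in L\setminus L^2$, of the decreasing sequences of sizes of the Jordan blocks of $R_x$. An $n$-dimensional naturally graded Leibniz algebra with characteristic sequence $(n-3,3)$ is of the first type if it has a basis $e_1,\dots,e_n$ with $e_1\notin L^2$ and $R_{e_1}=\operatorname{diag}(J_{n-3},J_3)$, that is, $[e_i,e_1]=e_{i+1}$ for $1\le i\le n-1$, $i\ne n-3$, and $[e_{n-3},e_1]=[e_n,e_1]=0$. **Theorem.** Let $n\ge 9$. Every $n$-dimensional naturally graded Leibniz algebra $L$ of the first type is isomorphic to one of the following algebras with basis $e_1,\dots,e_n$; each of these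 is a naturally graded Leibniz algebra of the first type, and they are pairwise non-isomorphic (for different families, and for different parameter values within a family). In all of them $[e_i,e_1]=e_{i+1}$ for $1\le i\le n-1$, $i\neq n-3$; the other nonzero products are contained in the following lists. - $L^{34}_{(0,\lambda,0)}$, $\lambda\in\mathbb{C}$: $[e_1,e_{n-2}]=\lambda e_{n-1}$, $[e_2,e_{n-2}]=\lambda e_n$. - $L^{35}_{(\mu,\lambda,1)}$, $\lambda,\mu\in\{0,1\}$: $[e_1,e_{n-2}]=\mu e_2+\lambda e_{n-1}$, $[e_2,e_{n-2}]=\mu e_3+\lambda e_n$, $[e_i,e_{n-2}]=\mu e_{i+1}$ $(3\le i\le n-4)$, $[e_i,e_{n-2}]=e_{i+1}$ $(n-2\le i\le n-1)$. - $L^{36}_{(1,\lambda,0)}$, $\lambda\in\{-1,0\}$: $[e_1,e_{n-2}]=e_2+\lambda e_{n-1}$, $[e_2,e_{n-2}]=e_3+\lambda e_n$, $[e_i,e_{n-2}]=e_{i+1}$ $(3\le i\le n-4)$. - $L^{37}_{(1,\lambda,2)}$, $\lambda\in\mathbb{C}$: $[e_1,e_{n-2}]=e_2+\lambda e_{n-1}$,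 $[e_2,e_{n-2}]=e_3+\lambda e_n$, $[e_i,e_{n-2}]=e_{i+1}$ $(3\le i\le n-4)$, $[e_i,e_{n-2}]=2e_{i+1}$ $(n-2\le i\le n-1)$. - $L^{38}_{(0,0,\lambda)}$, $\lambda\in\mathbb{C}\setminus\{0\}$: $[e_1,e_{n-2}]=-e_{n-1}$, $[e_2,e_{n-2}]=-(1+\lambda)e_n$, $[e_1,e_{n-1}]=\lambda e_n$. - $L^{39}_{(0,1,\lambda)}$, $\lambda\in\{-1,0\}$: $[e_1,e_{n-2}]=-e_{n-1}$, $[e_2,e_{n-2}]=-(1+\lambda)e_n$, $[e_{n-1},e_{n-2}]=-e_n$, $[e_1,e_{n-1}]=\lambda e_n$, $[e_{n-2},e_{n-1}]=e_n$. - $L^{40}_{(1,\lambda,\mu)}$, $\lambda\in\{0,1\}$, $\mu\in\mathbb{C}$, $(\lambda,\mu)\ne(0,0)$: $[e_1,e_{n-2}]=e_2-e_{n-1}$, $[e_2,e_{n-2}]=e_3-(1+\mu)e_n$, $[e_i,e_{n-2}]=e_{i+1}$ $(3\le i\le n-4)$, $[e_{n-1},e_{n-2}]=-\lambda e_n$,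 $[e_1,e_{n-1}]=\mu e_n$, $[e_{n-2},e_{n-1}]=\lambda e_n$. - $L^{41}_{(1,-1,\lambda)}$, $\lambda\in\{-1,0\}$: $[e_1,e_{n-2}]=e_2-e_{n-1}$, $[e_2,e_{n-2}]=e_3-(1+\lambda)e_n$, $[e_i,e_{n-2}]=e_{i+1}$ $(3\le i\le n-4)$, $[e_{n-1},e_{n-2}]=e_n$, $[e_1,e_{n-1}]=\lambda e_n$, $[e_{n-2},e_{n-1}]=-e_n$. Moreover, $e_n\in R(L)$ for every basis $e_1,\dots,e_n$ as in the definition of the first type. -/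

import Mathlib

noncomputable section

namespace NatGradedLeibniz

/-! An algebra structure on a complex vector space `L` is a bilinear map
`b : L →ₗ[ℂ] L →ₗ[ℂ] L`, and `b x y` is the bracket `[x, y]`. -/

section General

variable {L : Type*} [AddCommGroup L] [Module ℂ L]

/-- The (right) Leibniz identity `[x, [y, z]] = [[x, y], z] - [[x, z], y]`. -/
def IsLeibniz (b : L →ₗ[ℂ] L →ₗ[ℂ] L) : Prop :=
  ∀ x y z : L, b x (b y z) = b (b x y) z - b (b x z) y

/-- Isomorphism of algebras. -/
def Isomorphic {V W : Type*} [AddCommMonoid V] [Module ℂ V] [AddCommMonoid W] [Module ℂ W]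
    (b : V →ₗ[ℂ] V →ₗ[ℂ] V) (b' : W →ₗ[ℂ] W →ₗ[ℂ] W) : Prop :=
  ∃ φ : V ≃ₗ[ℂ] W, ∀ x y : V, φ (b x y) = b' (φ x) (φ y)

/-- The descending central series `L¹ = L`, `L^(k+1) = [L^k, L]`, with the index shifted by one:
`lcs b k` is `L^(k+1)`. -/
def lcs (b : L →ₗ[ℂ] L →ₗ[ℂ] L) : ℕ → Submodule ℂ L
  | 0 => ⊤
  | k + 1 => Submodule.map₂ b (lcs b k) ⊤

/-- The derived subalgebra `L² = [L, L]`. -/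
abbrev derived (b : L →ₗ[ℂ] L →ₗ[ℂ] L) : Submodule ℂ L := lcs b 1

/-- Nilpotency: some term of the descending central series vanishes. -/
def IsNilpotentAlg (b : L →ₗ[ℂ] L →ₗ[ℂ] L) : Prop := ∃ s : ℕ, lcs b s = ⊥

/-- The right annihilator `R(L) = {x | [y, x] = 0 for all y}`. -/
def rightAnnihilator (b : L →ₗ[ℂ] L →ₗ[ℂ] L) : Set L := {x | ∀ y : L, b y x = 0}

/-- The operator of right multiplication `R_x : y ↦ [y, x]`. -/
def rightMul (b : L →ₗ[ℂ] L →ₗ[ℂ] L) (x : L) : L →ₗ[ℂ] L := b.flip x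

/-! ### The associated graded algebra -/

theorem lcs_succ_le (b : L →ₗ[ℂ] L →ₗ[ℂ] L) (k : ℕ) : lcs b (k + 1) ≤ lcs b k := by
  induction k with
  | zero => exact le_top
  | succ k ih => exact Submodule.map₂_le_map₂ ih le_rfl

/-- `[L^i, L^j] ⊆ L^(i+j)`. -/
theorem bracket_mem_lcs {b : L →ₗ[ℂ] L →ₗ[ℂ] L} (hb : IsLeibniz b) (j : ℕ) :
    ∀ (i : ℕ) {x y : L}, x ∈ lcs b i → y ∈ lcs b j → b x y ∈ lcs b (i + j + 1) := by
  induction j with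
  | zero =>
    intro i x y hx _
    exact Submodule.apply_mem_map₂ b hx Submodule.mem_top
  | succ j ih =>
    intro i x y hx hy
    have key : lcs b (j + 1) ≤ (lcs b (i + (j + 1) + 1)).comap (b x) := by
      refine Submodule.map₂_le.2 fun y hy z _ => ?_
      rw [Submodule.mem_comap, hb x y z]
      refine Submodule.sub_mem _ ?_ ?_
      · exact Submodule.apply_mem_map₂ b (ih i hx hy) Submodule.mem_top
      · have hxz : b x z ∈ lcs b (i + 1) := Submodule.apply_mem_map₂ b hx Submodule.mem_top
        have h := ih (i + 1) hxz hy
        rwa [show i + 1 + j + 1 = i + (j + 1) + 1 by omega] at h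
    exact key hy

/-- The homogeneous component `L^(i+1) / L^(i+2)` of the associated graded algebra. -/
abbrev grPiece (b : L →ₗ[ℂ] L →ₗ[ℂ] L) (i : ℕ) : Type _ :=
  lcs b i ⧸ (lcs b (i + 1)).submoduleOf (lcs b i)

/-- The product `L^(i+1) × L^(j+1) → L^(i+j+2) / L^(i+j+3)` induced by the bracket. -/
def grPair (b : L →ₗ[ℂ] L →ₗ[ℂ] L) (hb : IsLeibniz b) (i j : ℕ) :
    lcs b i →ₗ[ℂ] lcs b j →ₗ[ℂ] grPiece b (i + j + 1) :=
  LinearMap.mk₂ ℂ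
    (fun x y => Submodule.Quotient.mk ⟨b x y, bracket_mem_lcs hb j i x.2 y.2⟩)
    (fun x x' y => by
      rw [← Submodule.Quotient.mk_add]; congr 1; ext; simp)
    (fun c x y => by
      rw [← Submodule.Quotient.mk_smul]; congr 1; ext; simp)
    (fun x y y' => by
      rw [← Submodule.Quotient.mk_add]; congr 1; ext; simp)
    (fun c x y => by
      rw [← Submodule.Quotient.mk_smul]; congr 1; ext; simp)

/-- The bracket of two homogeneous components of the associated graded algebra. -/
def grComponent (b : L →ₗ[ℂ] L →ₗ[ℂ] L) (hb : IsLeibniz b) (i j : ℕ) :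
    grPiece b i →ₗ[ℂ] grPiece b j →ₗ[ℂ] grPiece b (i + j + 1) :=
  (grPair b hb i j).liftQ₂ _ _
    (by
      intro x hx
      rw [LinearMap.mem_ker]
      ext y
      refine (Submodule.Quotient.mk_eq_zero _).2 ?_
      have h := bracket_mem_lcs hb j (i + 1) (Submodule.mem_comap.1 hx) y.2
      rw [show i + 1 + j + 1 = i + j + 1 + 1 by omega] at h
      exact h)
    (by
      intro y hy
      rw [LinearMap.mem_ker]
      ext x
      refine (Submodule.Quotient.mk_eq_zero _).2 ?_
      exact bracket_mem_lcs hb (j + 1) i x.2 (Submodule.mem_comap.1 hy))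

/-- The underlying space of the associated graded algebra `gr L = ⨁ L^i / L^(i+1)`. For nilpotent
`L` all but finitely many summands vanish. -/
abbrev Gr (b : L →ₗ[ℂ] L →ₗ[ℂ] L) : Type _ := DirectSum ℕ (grPiece b)

/-- The bracket of the associated graded algebra. -/
def grBracket (b : L →ₗ[ℂ] L →ₗ[ℂ] L) (hb : IsLeibniz b) : Gr b →ₗ[ℂ] Gr b →ₗ[ℂ] Gr b :=
  DirectSum.toModule ℂ ℕ _ fun i =>
    (DirectSum.toModule ℂ ℕ (grPiece b i →ₗ[ℂ] Gr b) fun j =>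
      ((grComponent b hb i j).compr₂ (DirectSum.lof ℂ ℕ (grPiece b) (i + j + 1))).flip).flip

/-- A naturally graded Leibniz algebra: a nilpotent Leibniz algebra isomorphic to its associated
graded algebra. -/
def IsNaturallyGraded (b : L →ₗ[ℂ] L →ₗ[ℂ] L) : Prop :=
  ∃ hb : IsLeibniz b, IsNilpotentAlg b ∧ Isomorphic b (grBracket b hb)

/-! ### Characteristic sequence and algebras of the first type -/

/-- `T` is nilpotent and `l` is the decreasing sequence of the sizes of its Jordan blocks: there is
a basis made of one chain `v₁ ↦ v₂ ↦ ⋯ ↦ v_m ↦ 0` for each entry `m` of `l`. -/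
def HasJordanSizes (T : L →ₗ[ℂ] L) (l : List ℕ) : Prop :=
  l.Pairwise (· ≥ ·) ∧ 0 ∉ l ∧
    ∃ v : Module.Basis (Σ k : Fin l.length, Fin (l.get k)) ℂ L,
      ∀ (k : Fin l.length) (i : Fin (l.get k)),
        T (v ⟨k, i⟩) = if h : (i : ℕ) + 1 < l.get k then v ⟨k, ⟨i + 1, h⟩⟩ else 0

/-- `l` is the characteristic sequence of the algebra: the lexicographic maximum, over
`x ∈ L \ L²`, of the sequences of Jordan block sizes of the operators `R_x`. -/
def IsCharacteristicSequence (b : L →ₗ[ℂ] L →ₗ[ℂ] L) (l : List ℕ) : Prop :=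
  (∃ x : L, x ∉ derived b ∧ HasJordanSizes (rightMul b x) l) ∧
    ∀ (y : L) (m : List ℕ), y ∉ derived b → HasJordanSizes (rightMul b y) m → m ≤ l

/-- The basis vector `e_k` in the numbering `e_1, …, e_n`; zero if `k` is not in `{1, …, n}`. -/
def vec {n : ℕ} (e : Module.Basis (Fin n) ℂ L) (k : ℕ) : L :=
  if h : 1 ≤ k ∧ k ≤ n then e ⟨k - 1, by omega⟩ else 0

/-- `e_1 ∉ L²` and in the basis `e_1, …, e_n` the operator `R_{e_1}` is
`diag(J_{n-3}, J_3)`, with `e_1, …, e_{n-3}` and `e_{n-2}, e_{n-1}, e_n` as Jordan chains. -/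
def IsFirstTypeBasis (b : L →ₗ[ℂ] L →ₗ[ℂ] L) {n : ℕ} (e : Module.Basis (Fin n) ℂ L) : Prop :=
  vec e 1 ∉ derived b ∧
    ∀ i : ℕ, 1 ≤ i → i ≤ n →
      rightMul b (vec e 1) (vec e i) = if i = n - 3 ∨ i = n then 0 else vec e (i + 1)

/-- A naturally graded Leibniz algebra of dimension `n` with characteristic sequence `(n-3, 3)`,
of the first type. -/
def IsFirstType (n : ℕ) (b : L →ₗ[ℂ] L →ₗ[ℂ] L) : Prop :=
  IsNaturallyGraded b ∧ IsCharacteristicSequence b [n - 3, 3] ∧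
    ∃ e : Module.Basis (Fin n) ℂ L, IsFirstTypeBasis b e

end General

/-! ### The multiplication tables -/

/-- The standard basis vector `e_k` of `ℂⁿ`, in the numbering `e_1, …, e_n`. -/
def E (n k : ℕ) : Fin n → ℂ := vec (Pi.basisFun ℂ (Fin n)) k

/-- The algebra on `ℂⁿ` with products `[e_i, e_j] = t i j`, `1 ≤ i, j ≤ n`. -/
def ofTable (n : ℕ) (t : ℕ → ℕ → (Fin n → ℂ)) :
    (Fin n → ℂ) →ₗ[ℂ] (Fin n → ℂ) →ₗ[ℂ] (Fin n → ℂ) :=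
  (Pi.basisFun ℂ (Fin n)).constr ℂ fun i =>
    (Pi.basisFun ℂ (Fin n)).constr ℂ fun j => t (i + 1) (j + 1)

def L34 (n : ℕ) (l : ℂ) := ofTable n fun i j =>
  if j = 1 ∧ i ≤ n - 1 ∧ i ≠ n - 3 then E n (i + 1)
  else if i = 1 ∧ j = n - 2 then l • E n (n - 1)
  else if i = 2 ∧ j = n - 2 then l • E n n
  else 0

def L35 (n : ℕ) (m l : ℂ) := ofTable n fun i j =>
  if j = 1 ∧ i ≤ n - 1 ∧ i ≠ n - 3 then E n (i + 1)
  else if i = 1 ∧ j = n - 2 then m • E n 2 + l • E n (n - 1)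
  else if i = 2 ∧ j = n - 2 then m • E n 3 + l • E n n
  else if 3 ≤ i ∧ i ≤ n - 4 ∧ j = n - 2 then m • E n (i + 1)
  else if n - 2 ≤ i ∧ i ≤ n - 1 ∧ j = n - 2 then E n (i + 1)
  else 0

def L36 (n : ℕ) (l : ℂ) := ofTable n fun i j =>
  if j = 1 ∧ i ≤ n - 1 ∧ i ≠ n - 3 then E n (i + 1)
  else if i = 1 ∧ j = n - 2 then E n 2 + l • E n (n - 1)
  else if i = 2 ∧ j = n - 2 then E n 3 + l • E n n
  else if 3 ≤ i ∧ i ≤ n - 4 ∧ j = n - 2 then E n (i + 1)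
  else 0

def L37 (n : ℕ) (l : ℂ) := ofTable n fun i j =>
  if j = 1 ∧ i ≤ n - 1 ∧ i ≠ n - 3 then E n (i + 1)
  else if i = 1 ∧ j = n - 2 then E n 2 + l • E n (n - 1)
  else if i = 2 ∧ j = n - 2 then E n 3 + l • E n n
  else if 3 ≤ i ∧ i ≤ n - 4 ∧ j = n - 2 then E n (i + 1)
  else if n - 2 ≤ i ∧ i ≤ n - 1 ∧ j = n - 2 then (2 : ℂ) • E n (i + 1)
  else 0

def L38 (n : ℕ) (l : ℂ) := ofTable n fun i j =>
  if j = 1 ∧ i ≤ n - 1 ∧ i ≠ n - 3 then E n (i + 1)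
  else if i = 1 ∧ j = n - 2 then -E n (n - 1)
  else if i = 2 ∧ j = n - 2 then -(1 + l) • E n n
  else if i = 1 ∧ j = n - 1 then l • E n n
  else 0

def L39 (n : ℕ) (l : ℂ) := ofTable n fun i j =>
  if j = 1 ∧ i ≤ n - 1 ∧ i ≠ n - 3 then E n (i + 1)
  else if i = 1 ∧ j = n - 2 then -E n (n - 1)
  else if i = 2 ∧ j = n - 2 then -(1 + l) • E n n
  else if i = n - 1 ∧ j = n - 2 then -E n n
  else if i = 1 ∧ j = n - 1 then l • E n n
  else if i = n - 2 ∧ j = n - 1 then E n n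
  else 0

def L40 (n : ℕ) (l m : ℂ) := ofTable n fun i j =>
  if j = 1 ∧ i ≤ n - 1 ∧ i ≠ n - 3 then E n (i + 1)
  else if i = 1 ∧ j = n - 2 then E n 2 - E n (n - 1)
  else if i = 2 ∧ j = n - 2 then E n 3 - (1 + m) • E n n
  else if 3 ≤ i ∧ i ≤ n - 4 ∧ j = n - 2 then E n (i + 1)
  else if i = n - 1 ∧ j = n - 2 then -l • E n n
  else if i = 1 ∧ j = n - 1 then m • E n n
  else if i = n - 2 ∧ j = n - 1 then l • E n n
  else 0

def L41 (n : ℕ) (l : ℂ) := ofTable n fun i j =>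
  if j = 1 ∧ i ≤ n - 1 ∧ i ≠ n - 3 then E n (i + 1)
  else if i = 1 ∧ j = n - 2 then E n 2 - E n (n - 1)
  else if i = 2 ∧ j = n - 2 then E n 3 - (1 + l) • E n n
  else if 3 ≤ i ∧ i ≤ n - 4 ∧ j = n - 2 then E n (i + 1)
  else if i = n - 1 ∧ j = n - 2 then E n n
  else if i = 1 ∧ j = n - 1 then l • E n n
  else if i = n - 2 ∧ j = n - 1 then -E n n
  else 0

/-- Names of the members of the eight families, with their parameters: `a34 l` is
`L³⁴_(0,l,0)`, `a35 m l` is `L³⁵_(m,l,1)`, `a36 l` is `L³⁶_(1,l,0)`, `a37 l` is `L³⁷_(1,l,2)`,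
`a38 l` is `L³⁸_(0,0,l)`, `a39 l` is `L³⁹_(0,1,l)`, `a40 l m` is `L⁴⁰_(1,l,m)` and
`a41 l` is `L⁴¹_(1,-1,l)`. -/
inductive Label : Type
  | a34 (l : ℂ)
  | a35 (m l : ℂ)
  | a36 (l : ℂ)
  | a37 (l : ℂ)
  | a38 (l : ℂ)
  | a39 (l : ℂ)
  | a40 (l m : ℂ)
  | a41 (l : ℂ)

/-- The ranges of the parameters. The values `l = 0` for `a38` and `(l, m) = (0, 0)` for `a40` are
excluded: there the tables are those of `a34 (-1)` and `a36 (-1)`. -/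
def Label.Admissible : Label → Prop
  | .a34 _ => True
  | .a35 m l => (m = 0 ∨ m = 1) ∧ (l = 0 ∨ l = 1)
  | .a36 l => l = -1 ∨ l = 0
  | .a37 _ => True
  | .a38 l => l ≠ 0
  | .a39 l => l = -1 ∨ l = 0
  | .a40 l m => (l = 0 ∧ m ≠ 0) ∨ l = 1
  | .a41 l => l = -1 ∨ l = 0

/-- The `n`-dimensional algebra with a given name. -/
def Label.algebra (n : ℕ) : Label → ((Fin n → ℂ) →ₗ[ℂ] (Fin n → ℂ) →ₗ[ℂ] (Fin n → ℂ))
  | .a34 l => L34 n l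
  | .a35 m l => L35 n m l
  | .a36 l => L36 n l
  | .a37 l => L37 n l
  | .a38 l => L38 n l
  | .a39 l => L39 n l
  | .a40 l m => L40 n l m
  | .a41 l => L41 n l

end NatGradedLeibniz

end

open NatGradedLeibniz

/-!
Let `L` be of the first type. The Euler derivation of `gr L`, carried over to `L` and corrected by
an inner derivation, is a derivation `D` acting as `k` on `L^k / L^(k+1)`. A fixed vector `x` of `D`
with `R_x = R_{e_1}` and a fixed vector `f` congruent to `e_{n-2}` modulo `L^2` generate `L`, and
`L` has a basis of eigenvectors of `D` formed by the chains `x, [x,x], …` and `f, [f,x], [[f,x],x]`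
of lengths `n - 3` and `3`. So each of `x` and `f` times a vector of the second chain is a
combination of at most two vectors of the basis. Since `n ≥ 9`, the first chain has length at least
`6`, long enough for the Leibniz identity to give `[L, [[f,x],x]] = 0` and to leave only the five
constants in `[x,f] = α [x,x] + β [f,x]`, `[f,f] = δ [f,x]`, `[x,[f,x]] = ν [[f,x],x]` and
`[f,[f,x]] = σ [[f,x],x]`, subject to `δν = δσ = (β + 1)ν = (β + 1)σ = 0`.

Passing to the generators `x + s f`, `d f` brings the constants to those of a listed algebra.
Conversely the coordinates of two pairs of generators show that any two tuples of constants of one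
algebra are related by such a change, and distinct listed tuples are not.
-/

noncomputable section

namespace NatGradedLeibniz

section Algebra

variable {L W : Type*} [AddCommGroup L] [Module ℂ L] [AddCommGroup W] [Module ℂ W]
  {b : L →ₗ[ℂ] L →ₗ[ℂ] L} {b' : W →ₗ[ℂ] W →ₗ[ℂ] W}

theorem rightMul_apply (b : L →ₗ[ℂ] L →ₗ[ℂ] L) (x y : L) : rightMul b x y = b y x := rfl

theorem rightMul_pow_succ (b : L →ₗ[ℂ] L →ₗ[ℂ] L) (x u : L) (k : ℕ) :
    (rightMul b x ^ (k + 1)) u = b ((rightMul b x ^ k) u) x := by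
  rw [pow_succ', Module.End.mul_apply, rightMul_apply]

theorem lcs_antitone (b : L →ₗ[ℂ] L →ₗ[ℂ] L) : Antitone (lcs b) :=
  antitone_nat_of_succ_le (lcs_succ_le b)

theorem bracket_mem_lcs_succ {k : ℕ} {u : L} (hu : u ∈ lcs b k) (v : L) : b u v ∈ lcs b (k + 1) :=
  Submodule.apply_mem_map₂ b hu Submodule.mem_top

theorem lcs_succ_le_iff {k : ℕ} {S : Submodule ℂ L} :
    lcs b (k + 1) ≤ S ↔ ∀ u ∈ lcs b k, ∀ v, b u v ∈ S :=
  Submodule.map₂_le.trans <| by simp only [Submodule.mem_top, true_imp_iff]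

theorem bracket_mem_derived (u v : L) : b u v ∈ derived b :=
  bracket_mem_lcs_succ Submodule.mem_top v

theorem rightMul_pow_mem_lcs (b : L →ₗ[ℂ] L →ₗ[ℂ] L) (x u : L) (k : ℕ) :
    (rightMul b x ^ k) u ∈ lcs b k := by
  induction k with
  | zero => exact Submodule.mem_top
  | succ k ih => rw [rightMul_pow_succ]; exact bracket_mem_lcs_succ ih x

theorem map_lcs (φ : L ≃ₗ[ℂ] W) (hφ : ∀ x y, φ (b x y) = b' (φ x) (φ y)) (k : ℕ) :
    (lcs b k).map (φ : L →ₗ[ℂ] W) = lcs b' k := by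
  induction k with
  | zero => simp [lcs]
  | succ k ih =>
    apply le_antisymm
    · rw [Submodule.map_le_iff_le_comap, lcs_succ_le_iff]
      intro x hx y
      rw [Submodule.mem_comap, LinearEquiv.coe_coe, hφ]
      exact bracket_mem_lcs_succ (ih ▸ Submodule.mem_map_of_mem hx) _
    · rw [lcs_succ_le_iff, ← ih]
      rintro _ ⟨x, hx, rfl⟩ y
      obtain ⟨y, rfl⟩ := φ.surjective y
      rw [LinearEquiv.coe_coe, ← hφ]
      exact Submodule.mem_map_of_mem (f := (φ : L →ₗ[ℂ] W)) (bracket_mem_lcs_succ hx y)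

theorem map_mem_lcs_iff (φ : L ≃ₗ[ℂ] W) (hφ : ∀ x y, φ (b x y) = b' (φ x) (φ y)) {k : ℕ}
    {x : L} : φ x ∈ lcs b' k ↔ x ∈ lcs b k := by
  rw [← map_lcs φ hφ]
  exact ⟨fun ⟨y, hy, h⟩ => by rwa [← φ.injective h], fun h => ⟨x, h, rfl⟩⟩

end Algebra

section Numbering

variable {L M : Type*} [AddCommGroup L] [Module ℂ L] [AddCommGroup M] [Module ℂ M] {n : ℕ}

/-- The coordinate of a vector along the `k`-th basis vector `vec e k`, in the numbering
`e_1, …, e_n`; zero if `k` is not in `{1, …, n}`. -/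
def coord (e : Module.Basis (Fin n) ℂ L) (k : ℕ) : L →ₗ[ℂ] ℂ :=
  if h : 1 ≤ k ∧ k ≤ n then e.coord ⟨k - 1, by omega⟩ else 0

variable (e : Module.Basis (Fin n) ℂ L)

theorem vec_succ (i : Fin n) : vec e (i + 1) = e i := by
  rw [vec, dif_pos ⟨by omega, by omega⟩]; rfl

theorem exists_vec_eq {k : ℕ} (hk : 1 ≤ k) (hk' : k ≤ n) :
    ∃ i : Fin n, (i : ℕ) + 1 = k ∧ vec e k = e i :=
  ⟨⟨k - 1, by omega⟩, by simp only; omega, by rw [vec, dif_pos ⟨hk, hk'⟩]⟩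

theorem vec_ne_zero {k : ℕ} (hk : 1 ≤ k) (hk' : k ≤ n) : vec e k ≠ 0 := by
  obtain ⟨i, -, h⟩ := exists_vec_eq e hk hk'
  exact h ▸ e.ne_zero i

theorem coord_vec (i k : ℕ) :
    coord e k (vec e i) = if i = k ∧ 1 ≤ k ∧ k ≤ n then 1 else 0 := by
  unfold coord vec
  by_cases hk : 1 ≤ k ∧ k ≤ n
  · by_cases hi : 1 ≤ i ∧ i ≤ n
    · rw [dif_pos hk, dif_pos hi, Module.Basis.coord_apply, Module.Basis.repr_self,
        Finsupp.single_apply]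
      exact if_congr (by rw [Fin.mk.injEq]; omega) rfl rfl
    · rw [dif_neg hi, map_zero, if_neg (by omega)]
  · rw [dif_neg hk, if_neg (by omega), LinearMap.zero_apply]

theorem vec_map (φ : L ≃ₗ[ℂ] M) (k : ℕ) : vec (e.map φ) k = φ (vec e k) := by
  unfold vec
  split_ifs <;> simp

variable {e}

theorem linearMap_ext_vec {f g : L →ₗ[ℂ] M}
    (h : ∀ i, 1 ≤ i → i ≤ n → f (vec e i) = g (vec e i)) : f = g :=
  e.ext fun i => by simpa only [vec_succ] using h (i + 1) (by omega) (by omega)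

theorem eq_top_of_vec_mem {S : Submodule ℂ L} (h : ∀ i, 1 ≤ i → i ≤ n → vec e i ∈ S) : S = ⊤ := by
  rw [eq_top_iff, ← e.span_eq, Submodule.span_le]
  rintro _ ⟨i, rfl⟩
  exact vec_succ e i ▸ h (i + 1) (by omega) (by omega)

theorem ext_coord {u v : L} (h : ∀ k, 1 ≤ k → k ≤ n → coord e k u = coord e k v) : u = v :=
  e.ext_elem fun i => by
    simpa [coord, show (i : ℕ) + 1 ≤ n by omega] using h (i + 1) (by omega) (by omega)

end Numbering

section WeightBasis

variable {L ι : Type*} [AddCommGroup L] [Module ℂ L] {b : L →ₗ[ℂ] L →ₗ[ℂ] L}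

theorem grBracket_lof (hb : IsLeibniz b) (i j : ℕ) (x : lcs b i) (y : lcs b j) :
    grBracket b hb (DirectSum.lof ℂ ℕ (grPiece b) i (Submodule.Quotient.mk x))
      (DirectSum.lof ℂ ℕ (grPiece b) j (Submodule.Quotient.mk y)) =
    DirectSum.lof ℂ ℕ (grPiece b) (i + j + 1)
      (Submodule.Quotient.mk ⟨b x y, bracket_mem_lcs hb j i x.2 y.2⟩) := by
  simp only [grBracket, DirectSum.toModule_lof, LinearMap.flip_apply, LinearMap.compr₂_apply]
  rfl

/-- The span of the basis vectors whose weight lies in `s`. -/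
def weightSpan (e : Module.Basis ι ℂ L) (wt : ι → ℕ) (s : Set ℕ) : Submodule ℂ L :=
  Submodule.span ℂ (e '' (wt ⁻¹' s))

/-- The projection onto the span of the basis vectors of weight `k`. -/
def weightProj (e : Module.Basis ι ℂ L) (wt : ι → ℕ) (k : ℕ) : L →ₗ[ℂ] L :=
  e.constr ℂ fun i => if wt i = k then e i else 0

/-- A basis of weight vectors for an algebra graded by the positive integers and generated in its
lowest degree. A weight `k` stands for the degree `k + 1`, as in `lcs`, whence the `+ 1` in the
weight of a bracket. -/
structure IsWeightBasis (b : L →ₗ[ℂ] L →ₗ[ℂ] L) (e : Module.Basis ι ℂ L) (wt : ι → ℕ) : Prop where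
  bracket_mem : ∀ i j, b (e i) (e j) ∈ weightSpan e wt {wt i + wt j + 1}
  exists_eq_bracket : ∀ i, wt i ≠ 0 → ∃ j v, wt i = wt j + 1 ∧ e i = b (e j) v

variable {e : Module.Basis ι ℂ L} {wt : ι → ℕ}

theorem mem_weightSpan {s : Set ℕ} {i : ι} (h : wt i ∈ s) : e i ∈ weightSpan e wt s :=
  Submodule.subset_span ⟨i, h, rfl⟩

theorem weightSpan_le {s : Set ℕ} {S : Submodule ℂ L} :
    weightSpan e wt s ≤ S ↔ ∀ i, wt i ∈ s → e i ∈ S := by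
  rw [weightSpan, Submodule.span_le, Set.image_subset_iff]
  rfl

theorem weightSpan_mono {s t : Set ℕ} (h : s ⊆ t) : weightSpan e wt s ≤ weightSpan e wt t :=
  weightSpan_le.2 fun _ hi => mem_weightSpan (h hi)

theorem weightSpan_Ici_zero : weightSpan e wt (Set.Ici 0) = ⊤ := by
  rw [eq_top_iff, ← e.span_eq, Submodule.span_le]
  rintro _ ⟨i, rfl⟩
  exact mem_weightSpan (Nat.zero_le _)

theorem weightSpan_Ici_eq_sup (k : ℕ) :
    weightSpan e wt (Set.Ici k) = weightSpan e wt {k} ⊔ weightSpan e wt (Set.Ici (k + 1)) := by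
  simp only [weightSpan, ← Submodule.span_union, ← Set.image_union, ← Set.preimage_union]
  congr 3
  ext m
  simp only [Set.mem_Ici, Set.mem_union, Set.mem_singleton_iff]
  omega

namespace IsWeightBasis

theorem lcs_eq (h : IsWeightBasis b e wt) (k : ℕ) : lcs b k = weightSpan e wt (Set.Ici k) := by
  induction k with
  | zero => exact weightSpan_Ici_zero.symm
  | succ k ih =>
    apply le_antisymm
    · have hbasis : ∀ j, weightSpan e wt (Set.Ici k) ≤
          (weightSpan e wt (Set.Ici (k + 1))).comap (b.flip (e j)) := fun j =>
        weightSpan_le.2 fun i hi => weightSpan_mono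
          (Set.singleton_subset_iff.2 (by simp only [Set.mem_Ici] at hi ⊢; omega))
          (h.bracket_mem i j)
      refine lcs_succ_le_iff.2 fun u hu v => ?_
      have hspan : Submodule.span ℂ (Set.range e) ≤
          (weightSpan e wt (Set.Ici (k + 1))).comap (b u) := by
        rw [Submodule.span_le]
        rintro _ ⟨j, rfl⟩
        exact hbasis j (ih ▸ hu)
      exact hspan (e.span_eq ▸ Submodule.mem_top)
    · refine weightSpan_le.2 fun i hi => ?_
      rw [Set.mem_Ici] at hi
      obtain ⟨j, v, hj, hij⟩ := h.exists_eq_bracket i (by omega)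
      rw [hij]
      exact bracket_mem_lcs_succ (ih ▸ mem_weightSpan (by rw [Set.mem_Ici]; omega)) v

theorem weightSpan_le_lcs (h : IsWeightBasis b e wt) (k : ℕ) : weightSpan e wt {k} ≤ lcs b k :=
  h.lcs_eq k ▸ weightSpan_mono (Set.singleton_subset_iff.2 Set.self_mem_Ici)

theorem mem_lcs (h : IsWeightBasis b e wt) (i : ι) : e i ∈ lcs b (wt i) :=
  h.weightSpan_le_lcs _ (mem_weightSpan rfl)

/-- The linear map to the associated graded algebra which sends each basis vector of weight `k` to
its class in the component of weight `k`. -/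
def toGr (h : IsWeightBasis b e wt) : L →ₗ[ℂ] Gr b :=
  e.constr ℂ fun i =>
    DirectSum.lof ℂ ℕ (grPiece b) (wt i) (Submodule.Quotient.mk ⟨e i, h.mem_lcs i⟩)

theorem toGr_apply_of_mem (h : IsWeightBasis b e wt) {k : ℕ} {u : L}
    (hu : u ∈ weightSpan e wt {k}) :
    h.toGr u = DirectSum.lof ℂ ℕ (grPiece b) k
      (Submodule.Quotient.mk ⟨u, h.weightSpan_le_lcs k hu⟩) := by
  induction hu using Submodule.span_induction with
  | mem u hu =>
    obtain ⟨i, rfl, rfl⟩ := hu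
    exact e.constr_basis ℂ _ i
  | zero => rw [map_zero]; exact (map_zero _).symm
  | add u v _ _ hu hv => rw [map_add, hu, hv, ← map_add]; rfl
  | smul c u _ hu => rw [map_smul, hu, ← map_smul]; rfl

theorem toGr_bracket (h : IsWeightBasis b e wt) (hb : IsLeibniz b) (u v : L) :
    h.toGr (b u v) = grBracket b hb (h.toGr u) (h.toGr v) := by
  have hbasis : b.compr₂ h.toGr = (grBracket b hb).compl₁₂ h.toGr h.toGr :=
    e.ext fun i => e.ext fun j => by
      rw [LinearMap.compr₂_apply, LinearMap.compl₁₂_apply,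
        h.toGr_apply_of_mem (h.bracket_mem i j), h.toGr_apply_of_mem (mem_weightSpan rfl),
        h.toGr_apply_of_mem (mem_weightSpan rfl), grBracket_lof]
  exact LinearMap.congr_fun₂ hbasis u v

theorem toGr_surjective (h : IsWeightBasis b e wt) : Function.Surjective h.toGr := by
  rw [← LinearMap.range_eq_top, eq_top_iff]
  intro z _
  induction z using DirectSum.induction_on with
  | zero => exact zero_mem _
  | add x y hx hy => exact add_mem (hx Submodule.mem_top) (hy Submodule.mem_top)
  | of k x =>
    obtain ⟨⟨u, hu⟩, rfl⟩ := Submodule.Quotient.mk_surjective _ x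
    obtain ⟨v, hv, w, hw, rfl⟩ := Submodule.mem_sup.1
      (weightSpan_Ici_eq_sup (e := e) (wt := wt) k ▸ h.lcs_eq k ▸ hu)
    refine ⟨v, (h.toGr_apply_of_mem hv).trans ?_⟩
    rw [DirectSum.lof_eq_of]
    congr 1
    refine (Submodule.Quotient.eq _).2 ?_
    change v - (v + w) ∈ lcs b (k + 1)
    rw [sub_add_cancel_left, h.lcs_eq]
    exact neg_mem hw

theorem lcs_succ_le_ker_weightProj (h : IsWeightBasis b e wt) (k : ℕ) :
    lcs b (k + 1) ≤ LinearMap.ker (weightProj e wt k) := by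
  rw [h.lcs_eq, weightSpan_le]
  intro i hi
  rw [LinearMap.mem_ker, weightProj, e.constr_basis,
    if_neg (by simp only [Set.mem_Ici] at hi; omega)]

theorem notMem_lcs_succ (h : IsWeightBasis b e wt) (i : ι) : e i ∉ lcs b (wt i + 1) := fun hi => by
  have hker := LinearMap.mem_ker.1 (h.lcs_succ_le_ker_weightProj _ hi)
  rw [weightProj, e.constr_basis, if_pos rfl] at hker
  exact e.ne_zero i hker

theorem lcs_eq_bot (h : IsWeightBasis b e wt) {N : ℕ} (hN : ∀ i, wt i < N) : lcs b N = ⊥ := by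
  rw [h.lcs_eq, eq_bot_iff, weightSpan_le]
  exact fun i hi => absurd hi (hN i).not_ge

theorem toGr_injective (h : IsWeightBasis b e wt) : Function.Injective h.toGr := by
  let fromGr : Gr b →ₗ[ℂ] L := DirectSum.toModule ℂ ℕ L fun k =>
    Submodule.liftQ _ (weightProj e wt k ∘ₗ (lcs b k).subtype)
      fun _ hx => h.lcs_succ_le_ker_weightProj k hx
  have hleft : fromGr ∘ₗ h.toGr = LinearMap.id := e.ext fun i => by
    rw [LinearMap.comp_apply, h.toGr_apply_of_mem (mem_weightSpan rfl)]
    simp only [fromGr, DirectSum.toModule_lof]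
    change weightProj e wt (wt i) (e i) = e i
    rw [weightProj, e.constr_basis, if_pos rfl]
  exact Function.LeftInverse.injective (g := fromGr) (LinearMap.congr_fun hleft)

theorem isNaturallyGraded (h : IsWeightBasis b e wt) (hb : IsLeibniz b) {N : ℕ}
    (hN : ∀ i, wt i < N) : IsNaturallyGraded b :=
  ⟨hb, ⟨N, h.lcs_eq_bot hN⟩,
    LinearEquiv.ofBijective h.toGr ⟨h.toGr_injective, h.toGr_surjective⟩, h.toGr_bracket hb⟩

end IsWeightBasis

end WeightBasis

section GradingDerivation

variable {L W : Type*} [AddCommGroup L] [Module ℂ L] [AddCommGroup W] [Module ℂ W]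
  {b : L →ₗ[ℂ] L →ₗ[ℂ] L} {b' : W →ₗ[ℂ] W →ₗ[ℂ] W}

/-- A derivation acting on `L^k / L^(k+1)` as multiplication by `k`; recall that `L^k` is
`lcs b (k - 1)`. -/
structure IsGradingDerivation (b : L →ₗ[ℂ] L →ₗ[ℂ] L) (D : L →ₗ[ℂ] L) : Prop where
  leibniz_rule : ∀ u v, D (b u v) = b (D u) v + b u (D v)
  sub_mem_lcs : ∀ k, ∀ u ∈ lcs b k, D u - ((k : ℂ) + 1) • u ∈ lcs b (k + 1)

theorem IsGradingDerivation.of_equiv {D : W →ₗ[ℂ] W} (hD : IsGradingDerivation b' D)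
    (φ : L ≃ₗ[ℂ] W) (hφ : ∀ x y, φ (b x y) = b' (φ x) (φ y)) :
    IsGradingDerivation b (φ.symm.toLinearMap ∘ₗ D ∘ₗ φ.toLinearMap) where
  leibniz_rule u v := φ.injective <| by simp [hφ, hD.leibniz_rule]
  sub_mem_lcs k u hu := by
    rw [← map_mem_lcs_iff φ hφ] at hu ⊢
    simpa using hD.sub_mem_lcs k _ hu

/-- The part of the associated graded algebra spanned by the components of weight at least `k`. -/
def grFiltration (b : L →ₗ[ℂ] L →ₗ[ℂ] L) (k : ℕ) : Submodule ℂ (Gr b) :=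
  ⨆ i : {i // k ≤ i}, LinearMap.range (DirectSum.lof ℂ ℕ (grPiece b) i)

theorem lof_mem_grFiltration {k i : ℕ} (h : k ≤ i) (x : grPiece b i) :
    DirectSum.lof ℂ ℕ (grPiece b) i x ∈ grFiltration b k :=
  Submodule.mem_iSup_of_mem ⟨i, h⟩ ⟨x, rfl⟩

theorem grFiltration_zero : grFiltration b 0 = ⊤ := by
  rw [eq_top_iff]
  intro z _
  induction z using DirectSum.induction_on with
  | zero => exact zero_mem _
  | add x y hx hy => exact add_mem (hx Submodule.mem_top) (hy Submodule.mem_top)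
  | of k x => exact lof_mem_grFiltration (Nat.zero_le k) x

theorem lcs_grBracket_le (hb : IsLeibniz b) (k : ℕ) :
    lcs (L := Gr b) (grBracket b hb) k ≤ grFiltration b k := by
  induction k with
  | zero => rw [grFiltration_zero]; exact le_top
  | succ k ih =>
    refine (Submodule.map₂_le_map₂ ih grFiltration_zero.ge).trans ?_
    simp only [grFiltration, Submodule.map₂_iSup_left, Submodule.map₂_iSup_right, iSup_le_iff]
    intro i j
    rw [Submodule.map₂_le]
    rintro _ ⟨x, rfl⟩ _ ⟨y, rfl⟩
    obtain ⟨x, rfl⟩ := Submodule.Quotient.mk_surjective _ x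
    obtain ⟨y, rfl⟩ := Submodule.Quotient.mk_surjective _ y
    rw [grBracket_lof]
    have := i.2
    exact lof_mem_grFiltration (by omega) _

theorem lof_mem_lcs_grBracket (hb : IsLeibniz b) (k : ℕ) (x : grPiece b k) :
    DirectSum.lof ℂ ℕ (grPiece b) k x ∈ lcs (L := Gr b) (grBracket b hb) k := by
  induction k with
  | zero => exact Submodule.mem_top
  | succ k ih =>
    obtain ⟨⟨u, hu⟩, rfl⟩ := Submodule.Quotient.mk_surjective _ x
    have hle : lcs b (k + 1) ≤ Submodule.map (lcs b (k + 1)).subtype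
        (Submodule.comap (DirectSum.lof ℂ ℕ (grPiece b) (k + 1) ∘ₗ Submodule.mkQ _)
          (lcs (L := Gr b) (grBracket b hb) (k + 1))) := by
      refine lcs_succ_le_iff.2 fun y hy z => ⟨⟨b y z, bracket_mem_lcs_succ hy z⟩, ?_, rfl⟩
      have hyz := bracket_mem_lcs_succ (b := grBracket b hb) (ih (Submodule.Quotient.mk ⟨y, hy⟩))
        (DirectSum.lof ℂ ℕ (grPiece b) 0 (Submodule.Quotient.mk ⟨z, Submodule.mem_top⟩))
      rw [grBracket_lof] at hyz
      exact hyz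
    obtain ⟨⟨v, hv⟩, hmem, rfl⟩ := hle hu
    exact hmem

theorem lcs_grBracket (hb : IsLeibniz b) (k : ℕ) :
    lcs (L := Gr b) (grBracket b hb) k = grFiltration b k := by
  refine le_antisymm (lcs_grBracket_le hb k) ?_
  simp only [grFiltration, iSup_le_iff]
  rintro ⟨i, hi⟩ _ ⟨x, rfl⟩
  exact lcs_antitone (L := Gr b) (grBracket b hb) hi (lof_mem_lcs_grBracket hb i x)

/-- The Euler derivation of the associated graded algebra, multiplication by `k + 1` on the
component of weight `k`. -/
def grEuler (b : L →ₗ[ℂ] L →ₗ[ℂ] L) : Gr b →ₗ[ℂ] Gr b :=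
  DirectSum.toModule ℂ ℕ _ fun k => ((k : ℂ) + 1) • DirectSum.lof ℂ ℕ (grPiece b) k

theorem grEuler_lof (k : ℕ) (x : grPiece b k) :
    grEuler b (DirectSum.lof ℂ ℕ (grPiece b) k x) =
      ((k : ℂ) + 1) • DirectSum.lof ℂ ℕ (grPiece b) k x := by
  rw [grEuler, DirectSum.toModule_lof]; rfl

theorem grEuler_grBracket (hb : IsLeibniz b) (u v : Gr b) :
    grEuler b (grBracket b hb u v) =
      grBracket b hb (grEuler b u) v + grBracket b hb u (grEuler b v) := by
  induction u using DirectSum.induction_on with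
  | zero => simp
  | add x y hx hy => simp only [map_add, LinearMap.add_apply, hx, hy]; abel
  | of i x =>
    induction v using DirectSum.induction_on with
    | zero => simp
    | add x y hx hy => simp only [map_add, hx, hy]; abel
    | of j y =>
      obtain ⟨x, rfl⟩ := Submodule.Quotient.mk_surjective _ x
      obtain ⟨y, rfl⟩ := Submodule.Quotient.mk_surjective _ y
      simp only [← DirectSum.lof_eq_of ℂ]
      rw [grEuler_lof, grEuler_lof, map_smul, map_smul, LinearMap.smul_apply, grBracket_lof,
        grEuler_lof]
      push_cast
      module

theorem grEuler_sub_mem {k : ℕ} {u : Gr b} (hu : u ∈ grFiltration b k) :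
    grEuler b u - ((k : ℂ) + 1) • u ∈ grFiltration b (k + 1) := by
  induction hu using Submodule.iSup_induction' with
  | zero => simp
  | add u v _ _ hu hv =>
    rw [map_add, smul_add, add_sub_add_comm (grEuler b u)]
    exact add_mem hu hv
  | mem i u hu =>
    obtain ⟨i, hi⟩ := i
    obtain ⟨x, rfl⟩ := hu
    rw [grEuler_lof, ← sub_smul _ _ (DirectSum.lof ℂ ℕ (grPiece b) i x)]
    rcases hi.eq_or_lt with rfl | h
    · rw [sub_self, zero_smul]; exact zero_mem _
    · exact Submodule.smul_mem _ _ (lof_mem_grFiltration h x)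

theorem isGradingDerivation_grEuler (hb : IsLeibniz b) :
    IsGradingDerivation (L := Gr b) (grBracket b hb) (grEuler b) where
  leibniz_rule := grEuler_grBracket hb
  sub_mem_lcs k u hu := by
    rw [lcs_grBracket] at hu ⊢
    exact grEuler_sub_mem hu

theorem IsNaturallyGraded.exists_isGradingDerivation (h : IsNaturallyGraded b) :
    ∃ D, IsGradingDerivation b D := by
  obtain ⟨hb, -, ψ, hψ⟩ := h
  exact ⟨_, (isGradingDerivation_grEuler hb).of_equiv ψ hψ⟩

namespace IsGradingDerivation

variable {D : L →ₗ[ℂ] L}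

theorem add_rightMul (hD : IsGradingDerivation b D) (hb : IsLeibniz b) (w : L) :
    IsGradingDerivation b (D + rightMul b w) where
  leibniz_rule u v := by
    simp only [LinearMap.add_apply, rightMul_apply, map_add, hD.leibniz_rule, hb u v w]
    abel
  sub_mem_lcs k u hu := by
    rw [LinearMap.add_apply, rightMul_apply, add_sub_right_comm]
    exact add_mem (hD.sub_mem_lcs k u hu) (bracket_mem_lcs_succ hu w)

theorem map_mem_lcs (hD : IsGradingDerivation b D) {k : ℕ} {u : L} (hu : u ∈ lcs b k) :
    D u ∈ lcs b k := by
  have h := add_mem (lcs_succ_le b k (hD.sub_mem_lcs k u hu))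
    (Submodule.smul_mem _ ((k : ℂ) + 1) hu)
  rwa [sub_add_cancel] at h

theorem map_mem_ker_flip (hD : IsGradingDerivation b D) {r : L}
    (hr : r ∈ LinearMap.ker b.flip) : D r ∈ LinearMap.ker b.flip := by
  simp only [LinearMap.mem_ker, LinearMap.ext_iff, LinearMap.flip_apply,
    LinearMap.zero_apply] at hr ⊢
  intro u
  have h := hD.leibniz_rule u r
  rwa [hr, hr, map_zero, zero_add, eq_comm] at h

theorem exists_eq_self (hD : IsGradingDerivation b D) (hnil : IsNilpotentAlg b)
    {S : Submodule ℂ L} (hS : ∀ r ∈ S, D r ∈ S) {u : L} (hu : D u - u ∈ S) :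
    ∃ v, D v = v ∧ v - u ∈ S := by
  have approx : ∀ m, ∃ v, v - u ∈ S ∧ D v - v ∈ S ∧ D v - v ∈ lcs b (m + 1) := by
    intro m
    induction m with
    | zero =>
      exact ⟨u, by simp, hu, by simpa using hD.sub_mem_lcs 0 u Submodule.mem_top⟩
    | succ m ih =>
      obtain ⟨v, hvu, hvS, hvm⟩ := ih
      have hm : (m : ℂ) + 1 ≠ 0 := m.cast_add_one_ne_zero
      have hdiff : D (v - ((m : ℂ) + 1)⁻¹ • (D v - v)) - (v - ((m : ℂ) + 1)⁻¹ • (D v - v)) =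
          -((m : ℂ) + 1)⁻¹ • (D (D v - v) - (((m + 1 : ℕ) : ℂ) + 1) • (D v - v)) := by
        push_cast
        simp only [map_sub, map_smul]
        linear_combination (norm := module) (mul_inv_cancel₀ hm) • (v - D v)
      refine ⟨v - ((m : ℂ) + 1)⁻¹ • (D v - v), ?_, ?_, ?_⟩
      · rw [sub_right_comm]
        exact sub_mem hvu (S.smul_mem _ hvS)
      · rw [hdiff]
        exact S.smul_mem _ (sub_mem (hS _ hvS) (S.smul_mem _ hvS))
      · rw [hdiff]
        exact Submodule.smul_mem _ _ (hD.sub_mem_lcs (m + 1) _ hvm)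
  obtain ⟨N, hN⟩ := hnil
  obtain ⟨v, hvu, -, hvN⟩ := approx N
  rw [eq_bot_iff.2 ((lcs_succ_le b N).trans hN.le), Submodule.mem_bot, sub_eq_zero] at hvN
  exact ⟨v, hvN, hvu⟩

theorem eq_zero_of_mem_lcs (hD : IsGradingDerivation b D) (hnil : IsNilpotentAlg b) {m k : ℕ}
    (hmk : m < k) {u : L} (hu : u ∈ lcs b k) (hDu : D u = ((m : ℂ) + 1) • u) : u = 0 := by
  have hall : ∀ j, u ∈ lcs b (k + j) := by
    intro j
    induction j with
    | zero => exact hu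
    | succ j ih =>
      have hne : (m : ℂ) - (k + j : ℕ) ≠ 0 := by
        rw [sub_ne_zero, Nat.cast_inj.ne]; omega
      have h := hD.sub_mem_lcs _ u ih
      rw [hDu, ← sub_smul, add_sub_add_right_eq_sub] at h
      exact (Submodule.smul_mem_iff _ hne).1 h
  obtain ⟨N, hN⟩ := hnil
  have h := lcs_antitone b (Nat.le_add_left N k) (hall N)
  rwa [hN, Submodule.mem_bot] at h

theorem map_pow_apply (hD : IsGradingDerivation b D) {x u : L} (hx : D x = x) (hu : D u = u)
    (k : ℕ) : D ((rightMul b x ^ k) u) = ((k : ℂ) + 1) • (rightMul b x ^ k) u := by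
  induction k with
  | zero => simpa using hu
  | succ k ih =>
    rw [rightMul_pow_succ, hD.leibniz_rule, ih, hx]
    push_cast
    rw [map_smul, LinearMap.smul_apply]; module

end IsGradingDerivation

end GradingDerivation

section FirstTypeBasis

variable {L : Type*} [AddCommGroup L] [Module ℂ L] {b : L →ₗ[ℂ] L →ₗ[ℂ] L}

theorem HasJordanSizes.sum_eq {T : L →ₗ[ℂ] L} {l : List ℕ} (h : HasJordanSizes T l) :
    l.sum = Module.finrank ℂ L := by
  obtain ⟨-, -, v, -⟩ := h
  rw [Module.finrank_eq_card_basis v]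
  simp

theorem HasJordanSizes.le_of_pow_eq_zero {T : L →ₗ[ℂ] L} {l : List ℕ} (h : HasJordanSizes T l)
    {N : ℕ} (hN : T ^ N = 0) {a : ℕ} (ha : a ∈ l) : a ≤ N := by
  obtain ⟨-, -, v, hv⟩ := h
  obtain ⟨k, rfl⟩ := List.get_of_mem ha
  by_contra! hlt
  have hchain : ∀ j, ∀ hj : j < l.get k,
      (T ^ j) (v ⟨k, ⟨0, Nat.zero_lt_of_lt hj⟩⟩) = v ⟨k, ⟨j, hj⟩⟩ := by
    intro j
    induction j with
    | zero => exact fun _ => rfl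
    | succ j ih =>
      intro hj
      rw [pow_succ', Module.End.mul_apply, ih (by omega), hv, dif_pos hj]
  exact v.ne_zero _ (by rw [← hchain N hlt, hN, LinearMap.zero_apply])

theorem le_pair_of_sum_eq {m : List ℕ} {k l : ℕ} (h0 : 0 ∉ m) (hle : ∀ a ∈ m, a ≤ k)
    (hsum : m.sum = k + l) : m ≤ [k, l] := by
  refine le_of_not_gt fun hlt => ?_
  rcases m with _ | ⟨a, _ | ⟨c, _ | ⟨d, r⟩⟩⟩ <;>
    simp only [List.not_lt_nil, List.cons_lt_cons_iff, List.sum_cons, List.mem_cons, not_or,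
      List.sum_nil, forall_eq_or_imp, forall_eq, List.not_mem_nil, and_false, or_false]
      at hlt hsum h0 hle <;>
    omega

theorem derived_le_range_of_sup_eq_top (hb : IsLeibniz b) (hnil : IsNilpotentAlg b) {x : L}
    (hx : Submodule.span ℂ {x} ⊔ derived b = ⊤) :
    derived b ≤ LinearMap.range (rightMul b x) := by
  have hstep : ∀ k, lcs b (k + 1) ≤ LinearMap.range (rightMul b x) ⊔ lcs b (k + 2) := by
    refine fun k => lcs_succ_le_iff.2 fun u hu v => ?_
    obtain ⟨y, hy, v, hv, rfl⟩ := Submodule.mem_sup.1 (hx.ge (Submodule.mem_top (x := v)))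
    obtain ⟨c, rfl⟩ := Submodule.mem_span_singleton.1 hy
    rw [map_add]
    refine add_mem (Submodule.mem_sup_left ⟨c • u, ?_⟩) (Submodule.mem_sup_right ?_)
    · rw [rightMul_apply, map_smul, map_smul, LinearMap.smul_apply]
    · exact bracket_mem_lcs hb 1 k hu hv
  have hall : ∀ k, derived b ≤ LinearMap.range (rightMul b x) ⊔ lcs b (k + 1) := by
    intro k
    induction k with
    | zero => exact le_sup_right
    | succ k ih => exact ih.trans (sup_le le_sup_left (hstep k))
  obtain ⟨N, hN⟩ := hnil
  refine (hall N).trans (sup_le le_rfl ?_)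
  exact ((lcs_succ_le b N).trans hN.le).trans bot_le

namespace IsFirstTypeBasis

variable {n : ℕ} {e : Module.Basis (Fin n) ℂ L}

theorem hasJordanSizes (hn : 6 ≤ n) (he : IsFirstTypeBasis b e) :
    HasJordanSizes (rightMul b (vec e 1)) [n - 3, 3] := by
  refine ⟨by simp; omega, by simp; omega, ?_⟩
  let g : (Σ k : Fin [n - 3, 3].length, Fin ([n - 3, 3].get k)) → Fin n := fun p =>
    ⟨(n - 3) * p.1 + p.2, by
      obtain ⟨k, i⟩ := p
      fin_cases k <;> have := i.2 <;> simp at this ⊢ <;> omega⟩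
  have hg : Function.Bijective g := by
    constructor
    · rintro ⟨k, i⟩ ⟨k', i'⟩ h
      fin_cases k <;> fin_cases k' <;> have h1 := i.2 <;> have h2 := i'.2 <;>
        simp [g] at h h1 h2 ⊢ <;> omega
    · intro j
      by_cases hj : (j : ℕ) < n - 3
      · exact ⟨⟨⟨0, by simp⟩, ⟨j, by simpa using hj⟩⟩, by simp [g]⟩
      · refine ⟨⟨⟨1, by simp⟩, ⟨j - (n - 3), by simp; omega⟩⟩, ?_⟩
        ext
        simp [g]; omega
  refine ⟨e.reindex (Equiv.ofBijective g hg).symm, fun k i => ?_⟩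
  simp only [Module.Basis.reindex_apply, Equiv.symm_symm, Equiv.ofBijective_apply]
  rw [← vec_succ, he.2 _ (by omega) (by omega)]
  fin_cases k <;> have hi := i.2 <;> simp [g, ← vec_succ] at hi ⊢ <;> grind

theorem bracket (he : IsFirstTypeBasis b e) {i : ℕ} (hi : 1 ≤ i) (hi' : i ≤ n - 1)
    (h : i ≠ n - 3) : b (vec e i) (vec e 1) = vec e (i + 1) := by
  rw [← rightMul_apply, he.2 i hi (by omega), if_neg (by omega)]

theorem bracket_last (he : IsFirstTypeBasis b e) {i : ℕ} (hi : 1 ≤ i) (hi' : i ≤ n)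
    (h : i = n - 3 ∨ i = n) : b (vec e i) (vec e 1) = 0 := by
  rw [← rightMul_apply, he.2 i hi hi', if_pos h]

theorem bracket_bracket_sub_two (he : IsFirstTypeBasis b e) (hn : 6 ≤ n) :
    b (b (vec e (n - 2)) (vec e 1)) (vec e 1) = vec e n := by
  rw [he.bracket (by omega) (by omega) (by omega), he.bracket (by omega) (by omega) (by omega),
    show n - 2 + 1 + 1 = n by omega]

theorem pow_eq_zero (he : IsFirstTypeBasis b e) (hn : 6 ≤ n) :
    rightMul b (vec e 1) ^ (n - 3) = 0 := by
  have hchain : ∀ k i, 1 ≤ i → i ≤ n → n - 3 < i + k → i ≤ n - 3 ∨ n < i + k →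
      (rightMul b (vec e 1) ^ k) (vec e i) = 0 := by
    intro k
    induction k with
    | zero => intro i _ _ _ _; omega
    | succ k ih =>
      intro i hi hi' h1 h2
      rw [pow_succ, Module.End.mul_apply, rightMul_apply]
      by_cases hl : i = n - 3 ∨ i = n
      · rw [he.bracket_last hi hi' hl, map_zero]
      · rw [he.bracket hi (by omega) (by omega)]
        exact ih _ (by omega) (by omega) (by omega) (by omega)
  exact linearMap_ext_vec fun i hi hi' => hchain _ i hi hi' (by omega) (by omega)

theorem exists_eq_add_bracket (he : IsFirstTypeBasis b e) (v : L) :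
    ∃ s t : ℂ, ∃ w, v = s • vec e 1 + t • vec e (n - 2) + b w (vec e 1) := by
  have h : Submodule.span ℂ {vec e 1, vec e (n - 2)} ⊔
      LinearMap.range (rightMul b (vec e 1)) = ⊤ := by
    refine eq_top_of_vec_mem (e := e) fun i hi hi' => ?_
    by_cases h1 : i = 1
    · exact Submodule.mem_sup_left (Submodule.subset_span (by simp [h1]))
    by_cases h2 : i = n - 2
    · exact Submodule.mem_sup_left (Submodule.subset_span (by simp [h2]))
    refine Submodule.mem_sup_right ⟨vec e (i - 1), ?_⟩
    rw [rightMul_apply, he.bracket (by omega) (by omega) (by omega), Nat.sub_add_cancel hi]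
  obtain ⟨y, hy, _, ⟨w, rfl⟩, hv⟩ := Submodule.mem_sup.1 (h.ge (Submodule.mem_top (x := v)))
  obtain ⟨s, t, rfl⟩ := Submodule.mem_span_pair.1 hy
  exact ⟨s, t, w, hv.symm⟩

theorem span_sup_derived_eq_top (he : IsFirstTypeBasis b e) {s t : ℂ} (ht : t ≠ 0)
    (hst : s • vec e 1 + t • vec e (n - 2) ∈ derived b) :
    Submodule.span ℂ {vec e 1} ⊔ derived b = ⊤ := by
  have hx : vec e 1 ∈ Submodule.span ℂ {vec e 1} ⊔ derived b :=
    Submodule.mem_sup_left (Submodule.mem_span_singleton_self _)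
  have hf : vec e (n - 2) ∈ Submodule.span ℂ {vec e 1} ⊔ derived b := by
    rw [← Submodule.smul_mem_iff _ ht, ← Submodule.add_mem_iff_right _ (Submodule.smul_mem _ s hx)]
    exact Submodule.mem_sup_right hst
  refine eq_top_iff.2 fun v _ => ?_
  obtain ⟨s', t', w, rfl⟩ := he.exists_eq_add_bracket v
  exact add_mem (add_mem (Submodule.smul_mem _ s' hx) (Submodule.smul_mem _ t' hf))
    (Submodule.mem_sup_right (bracket_mem_derived _ _))

theorem derived_le_range (he : IsFirstTypeBasis b e) (hb : IsLeibniz b) (hnil : IsNilpotentAlg b) :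
    derived b ≤ LinearMap.range (rightMul b (vec e 1)) := by
  intro y hy
  obtain ⟨s, t, w, rfl⟩ := he.exists_eq_add_bracket y
  rw [Submodule.add_mem_iff_left _ (bracket_mem_derived _ _)] at hy
  rcases eq_or_ne t 0 with rfl | ht
  · rw [zero_smul, add_zero] at hy
    have hs : s = 0 := by
      by_contra hs
      exact he.1 ((Submodule.smul_mem_iff _ hs).1 hy)
    exact ⟨w, by rw [hs, zero_smul, zero_smul, zero_add, zero_add, rightMul_apply]⟩
  · exact derived_le_range_of_sup_eq_top hb hnil (he.span_sup_derived_eq_top ht hy)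
      (add_mem hy (bracket_mem_derived _ _))

theorem isFirstType (he : IsFirstTypeBasis b e) (hn : 6 ≤ n) (hb : IsNaturallyGraded b)
    (hbot : lcs b (n - 3) = ⊥) : IsFirstType n b := by
  refine ⟨hb, ⟨⟨_, he.1, he.hasJordanSizes hn⟩, fun y m _ hm => ?_⟩, e, he⟩
  have hsum : m.sum = n - 3 + 3 := by
    rw [hm.sum_eq, Module.finrank_eq_card_basis e, Fintype.card_fin]; omega
  have hpow : rightMul b y ^ (n - 3) = 0 := LinearMap.ext fun u =>
    (Submodule.mem_bot ℂ).1 (hbot ▸ rightMul_pow_mem_lcs b y u (n - 3))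
  exact le_pair_of_sum_eq hm.2.1 (fun a ha => hm.le_of_pow_eq_zero hpow ha) hsum

end IsFirstTypeBasis

end FirstTypeBasis

section StandardBasis

/-- The structure constants of a homogeneous algebra of the first type: for generators `x`, `f`
these are the coefficients in `[x, f] = α [x, x] + β [f, x]`, `[f, f] = δ [f, x]`,
`[x, [f, x]] = ν [[f, x], x]` and `[f, [f, x]] = σ [[f, x], x]`. -/
structure Params where
  α : ℂ
  β : ℂ
  δ : ℂ
  ν : ℂ
  σ : ℂ

namespace Params

/-- The relations among the structure constants which express the Leibniz identity. -/
structure Good (P : Params) : Prop where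
  δ_mul_ν : P.δ * P.ν = 0
  δ_mul_σ : P.δ * P.σ = 0
  β_mul_ν : (P.β + 1) * P.ν = 0
  β_mul_σ : (P.β + 1) * P.σ = 0

/-- The product `[e_i, e_j]` in the algebra with given structure constants. -/
def table {M : Type*} [AddCommGroup M] [Module ℂ M] (P : Params) (n : ℕ) (e : ℕ → M)
    (i j : ℕ) : M :=
  if j = 1 ∧ i ≤ n - 1 ∧ i ≠ n - 3 then e (i + 1)
  else if i = 1 ∧ j = n - 2 then P.α • e 2 + P.β • e (n - 1)
  else if i = 2 ∧ j = n - 2 then P.α • e 3 + (P.β - P.ν) • e n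
  else if 3 ≤ i ∧ i ≤ n - 4 ∧ j = n - 2 then P.α • e (i + 1)
  else if i = n - 2 ∧ j = n - 2 then P.δ • e (n - 1)
  else if i = n - 1 ∧ j = n - 2 then (P.δ - P.σ) • e n
  else if i = 1 ∧ j = n - 1 then P.ν • e n
  else if i = n - 2 ∧ j = n - 1 then P.σ • e n
  else 0

end Params

/-- `e` is a basis in which the algebra has the multiplication table with structure
constants `P`. -/
def IsStandardBasis {L : Type*} [AddCommGroup L] [Module ℂ L] {n : ℕ} (P : Params)
    (b : L →ₗ[ℂ] L →ₗ[ℂ] L) (e : Module.Basis (Fin n) ℂ L) : Prop :=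
  ∀ i j, 1 ≤ i → i ≤ n → 1 ≤ j → j ≤ n → b (vec e i) (vec e j) = P.table n (vec e) i j

namespace Label

/-- The structure constants of the listed algebras. -/
def params : Label → Params
  | .a34 l => ⟨0, l, 0, 0, 0⟩
  | .a35 m l => ⟨m, l, 1, 0, 0⟩
  | .a36 l => ⟨1, l, 0, 0, 0⟩
  | .a37 l => ⟨1, l, 2, 0, 0⟩
  | .a38 l => ⟨0, -1, 0, l, 0⟩
  | .a39 l => ⟨0, -1, 0, l, 1⟩
  | .a40 l m => ⟨1, -1, 0, m, l⟩
  | .a41 l => ⟨1, -1, 0, l, -1⟩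

theorem good_params (p : Label) : p.params.Good := by
  cases p <;> constructor <;> simp [Label.params]

end Label

theorem ofTable_E {n : ℕ} (t : ℕ → ℕ → (Fin n → ℂ)) {i j : ℕ} (hi : 1 ≤ i)
    (hi' : i ≤ n) (hj : 1 ≤ j) (hj' : j ≤ n) : ofTable n t (E n i) (E n j) = t i j := by
  obtain ⟨i, rfl, hi⟩ := exists_vec_eq (Pi.basisFun ℂ (Fin n)) hi hi'
  obtain ⟨j, rfl, hj⟩ := exists_vec_eq (Pi.basisFun ℂ (Fin n)) hj hj'
  rw [E, E, hi, hj, ofTable, Module.Basis.constr_basis, Module.Basis.constr_basis]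

theorem Label.isStandardBasis {n : ℕ} (hn : 7 ≤ n) (p : Label) :
    IsStandardBasis p.params (p.algebra n) (Pi.basisFun ℂ (Fin n)) := by
  intro i j hi hi' hj hj'
  change p.algebra n (E n i) (E n j) = p.params.table n (E n) i j
  cases p <;>
  · rw [algebra]
    first | rw [L34] | rw [L35] | rw [L36] | rw [L37] | rw [L38] | rw [L39] | rw [L40] | rw [L41]
    rw [ofTable_E _ hi hi' hj hj', Params.table, params]
    simp only [zero_smul, one_smul, neg_smul, add_smul, sub_smul, zero_add, sub_zero, zero_sub,
      neg_add, sub_neg_eq_add, ← sub_eq_add_neg, ite_self]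
    try grind

end StandardBasis

/-- The weight of `e_k` in a standard basis, one less than its degree: the two Jordan chains
`e_1, …, e_{n-3}` and `e_{n-2}, e_{n-1}, e_n` both start in degree one. -/
def chainWeight (n k : ℕ) : ℕ := if k ≤ n - 3 then k - 1 else k - (n - 2)

theorem chainWeight_lt {n : ℕ} (hn : 7 ≤ n) (i : Fin n) : chainWeight n (i + 1) < n - 3 := by
  unfold chainWeight
  grind

theorem vec_mem_weightSpan {L : Type*} [AddCommGroup L] [Module ℂ L] {n : ℕ}
    (e : Module.Basis (Fin n) ℂ L) {k m : ℕ} (h : 1 ≤ k ∧ k ≤ n ∧ chainWeight n k = m) :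
    vec e k ∈ weightSpan e (fun i => chainWeight n (i + 1)) {m} := by
  obtain ⟨i, rfl, hi⟩ := exists_vec_eq e h.1 h.2.1
  exact hi ▸ mem_weightSpan h.2.2

namespace IsStandardBasis

variable {L : Type*} [AddCommGroup L] [Module ℂ L] {n : ℕ} {P : Params}
  {b : L →ₗ[ℂ] L →ₗ[ℂ] L} {e : Module.Basis (Fin n) ℂ L}

theorem coord_bracket_eq (he : IsStandardBasis P b e) {k : ℕ} {g : L →ₗ[ℂ] L →ₗ[ℂ] ℂ}
    (hg : ∀ i j, 1 ≤ i → i ≤ n → 1 ≤ j → j ≤ n →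
      coord e k (P.table n (vec e) i j) = g (vec e i) (vec e j)) (v w : L) :
    coord e k (b v w) = g v w := by
  have : b.compr₂ (coord e k) = g := linearMap_ext_vec (e := e) fun i hi hi' =>
    linearMap_ext_vec (e := e) fun j hj hj' => by
      rw [LinearMap.compr₂_apply, he i j hi hi' hj hj', hg i j hi hi' hj hj']
  exact LinearMap.congr_fun₂ this v w

theorem coord_bracket_of_le (he : IsStandardBasis P b e) (hn : 7 ≤ n) {k : ℕ} (hk : k ≤ n - 3)
    (v w : L) :
    coord e k (b v w) = coord e (k - 1) v * (coord e 1 w + P.α * coord e (n - 2) w) := by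
  refine he.coord_bracket_eq
    (g := (coord e (k - 1)).smulRight (coord e 1 + P.α • coord e (n - 2)))
    (fun i j _ _ _ _ => ?_) v w
  simp only [LinearMap.smulRight_apply, LinearMap.add_apply, LinearMap.smul_apply, smul_eq_mul,
    Params.table, apply_ite (coord e k), map_add, map_smul, map_zero, coord_vec]
  grind

theorem coord_bracket_sub_two (he : IsStandardBasis P b e) (hn : 7 ≤ n) (v w : L) :
    coord e (n - 2) (b v w) = 0 := by
  refine he.coord_bracket_eq (g := 0) (fun i j _ _ _ _ => ?_) v w
  simp only [LinearMap.zero_apply, Params.table, apply_ite (coord e _), map_add, map_smul,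
    map_zero, coord_vec, smul_eq_mul]
  grind

theorem coord_bracket_sub_one (he : IsStandardBasis P b e) (hn : 7 ≤ n) (v w : L) :
    coord e (n - 1) (b v w) = coord e (n - 2) v * coord e 1 w +
      (P.β * coord e 1 v + P.δ * coord e (n - 2) v) * coord e (n - 2) w := by
  refine he.coord_bracket_eq
    (g := (coord e (n - 2)).smulRight (coord e 1) +
      (P.β • coord e 1 + P.δ • coord e (n - 2)).smulRight (coord e (n - 2)))
    (fun i j _ _ _ _ => ?_) v w
  simp only [LinearMap.smulRight_apply, LinearMap.add_apply, LinearMap.smul_apply, smul_eq_mul,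
    Params.table, apply_ite (coord e _), map_add, map_smul, map_zero, coord_vec]
  grind

theorem coord_bracket_last (he : IsStandardBasis P b e) (hn : 7 ≤ n) (v w : L) :
    coord e n (b v w) = coord e (n - 1) v * coord e 1 w +
      ((P.β - P.ν) * coord e 2 v + (P.δ - P.σ) * coord e (n - 1) v) * coord e (n - 2) w +
      (P.ν * coord e 1 v + P.σ * coord e (n - 2) v) * coord e (n - 1) w := by
  refine he.coord_bracket_eq
    (g := (coord e (n - 1)).smulRight (coord e 1) +
      ((P.β - P.ν) • coord e 2 + (P.δ - P.σ) • coord e (n - 1)).smulRight (coord e (n - 2)) +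
      (P.ν • coord e 1 + P.σ • coord e (n - 2)).smulRight (coord e (n - 1)))
    (fun i j _ _ _ _ => ?_) v w
  simp only [LinearMap.smulRight_apply, LinearMap.add_apply, LinearMap.smul_apply, smul_eq_mul,
    Params.table, apply_ite (coord e _), map_add, map_smul, map_zero, coord_vec]
  grind

theorem coord_one_bracket (he : IsStandardBasis P b e) (hn : 7 ≤ n) (v w : L) :
    coord e 1 (b v w) = 0 := by
  rw [he.coord_bracket_of_le hn (by omega), coord, dif_neg (by omega), LinearMap.zero_apply,
    zero_mul]

theorem isLeibniz (he : IsStandardBasis P b e) (hn : 7 ≤ n) (hP : P.Good) : IsLeibniz b := by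
  intro x y z
  refine ext_coord (e := e) fun k hk hk' => ?_
  have h0 := he.coord_bracket_sub_two hn
  have h1 := he.coord_one_bracket hn
  have h2 := he.coord_bracket_of_le hn (show 2 ≤ n - 3 by omega)
  have h3 := he.coord_bracket_sub_one hn
  have h4 := he.coord_bracket_last hn
  rw [map_sub]
  obtain hk | rfl | rfl | rfl : k ≤ n - 3 ∨ k = n - 2 ∨ k = n - 1 ∨ n = k := by omega
  · have hk₁ : k - 1 ≤ n - 3 := by omega
    simp only [he.coord_bracket_of_le hn hk, he.coord_bracket_of_le hn hk₁, h0, h1]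
    ring
  · simp only [h0, sub_zero]
  · simp only [h3, h0, h1]
    ring
  · simp only [h4, h3, h2, h1, h0]
    linear_combination coord e (n - 2) z * (coord e 1 y * (coord e 1 x * hP.β_mul_ν +
      coord e (n - 2) x * hP.β_mul_σ) + coord e (n - 2) y * (coord e 1 x * hP.δ_mul_ν +
      coord e (n - 2) x * hP.δ_mul_σ))

theorem bracket_one (he : IsStandardBasis P b e) {i : ℕ} (hi : 1 ≤ i) (hi' : i ≤ n - 1)
    (h : i ≠ n - 3) : b (vec e i) (vec e 1) = vec e (i + 1) := by
  rw [he i 1 hi (by omega) le_rfl (by omega), Params.table, if_pos ⟨rfl, hi', h⟩]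

theorem isWeightBasis (he : IsStandardBasis P b e) (hn : 7 ≤ n) :
    IsWeightBasis b e fun i => chainWeight n (i + 1) where
  bracket_mem i j := by
    rw [← vec_succ, ← vec_succ, he _ _ (by omega) (by omega) (by omega) (by omega), Params.table]
    split_ifs
    all_goals
      first
      | exact zero_mem _
      | refine add_mem (Submodule.smul_mem _ _ ?_) (Submodule.smul_mem _ _ ?_)
      | refine Submodule.smul_mem _ _ ?_
      | skip
    all_goals exact vec_mem_weightSpan e (by unfold chainWeight; grind)
  exists_eq_bracket i hi := by
    have hi' : (i : ℕ) ≠ 0 ∧ (i : ℕ) ≠ n - 3 := by unfold chainWeight at hi; grind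
    refine ⟨⟨i - 1, by omega⟩, vec e 1, by unfold chainWeight; grind, ?_⟩
    rw [← vec_succ, ← vec_succ, he.bracket_one] <;> grind

theorem isFirstTypeBasis (he : IsStandardBasis P b e) (hn : 7 ≤ n) : IsFirstTypeBasis b e := by
  refine ⟨?_, fun i hi hi' => ?_⟩
  · have := (he.isWeightBasis hn).notMem_lcs_succ ⟨0, by omega⟩
    rw [← vec_succ] at this
    simpa only [chainWeight, zero_add, show 1 ≤ n - 3 by omega, if_true] using this
  · rw [rightMul_apply]
    split_ifs with h
    · rw [he i 1 hi hi' le_rfl (by omega), Params.table]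
      repeat rw [if_neg (by omega)]
    · exact he.bracket_one hi (by omega) (by omega)

theorem isFirstType (he : IsStandardBasis P b e) (hn : 7 ≤ n) (hP : P.Good) : IsFirstType n b :=
  (he.isFirstTypeBasis hn).isFirstType (by omega)
    ((he.isWeightBasis hn).isNaturallyGraded (he.isLeibniz hn hP) (chainWeight_lt hn))
    ((he.isWeightBasis hn).lcs_eq_bot (chainWeight_lt hn))

end IsStandardBasis

section Isomorphic

variable {L W : Type*} [AddCommGroup L] [Module ℂ L] [AddCommGroup W] [Module ℂ W] {n : ℕ}
  {P : Params} {b : L →ₗ[ℂ] L →ₗ[ℂ] L} {b' : W →ₗ[ℂ] W →ₗ[ℂ] W}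

theorem table_map {M N : Type*} [AddCommGroup M] [Module ℂ M] [AddCommGroup N] [Module ℂ N]
    (φ : M →ₗ[ℂ] N) (P : Params) (n : ℕ) (e : ℕ → M) (i j : ℕ) :
    φ (P.table n e i j) = P.table n (fun k => φ (e k)) i j := by
  simp only [Params.table, apply_ite φ, map_add, map_smul, map_zero]

theorem IsStandardBasis.map {e : Module.Basis (Fin n) ℂ L} (he : IsStandardBasis P b e)
    {φ : L ≃ₗ[ℂ] W} (hφ : ∀ x y, φ (b x y) = b' (φ x) (φ y)) : IsStandardBasis P b' (e.map φ) := by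
  intro i j hi hi' hj hj'
  have h := table_map φ.toLinearMap P n (vec e) i j
  rw [LinearEquiv.coe_coe, ← he i j hi hi' hj hj', hφ] at h
  simpa only [← vec_map] using h

theorem IsStandardBasis.isomorphic {e : Module.Basis (Fin n) ℂ L} {e' : Module.Basis (Fin n) ℂ W}
    (he : IsStandardBasis P b e) (he' : IsStandardBasis P b' e') : Isomorphic b b' := by
  set φ := e.equiv e' (Equiv.refl _)
  have hφ (k : ℕ) : φ (vec e k) = vec e' k := by
    rw [← vec_map, Module.Basis.map_equiv, Equiv.refl_symm, Module.Basis.reindex_refl]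
  refine ⟨φ, fun x y => ?_⟩
  have : b.compr₂ φ.toLinearMap = b'.compl₁₂ φ.toLinearMap φ.toLinearMap :=
    linearMap_ext_vec (e := e) fun i hi hi' => linearMap_ext_vec (e := e) fun j hj hj' => by
      have h := table_map φ.toLinearMap P n (vec e) i j
      simp only [LinearMap.compr₂_apply, LinearMap.compl₁₂_apply, LinearEquiv.coe_coe, hφ] at h ⊢
      rw [he i j hi hi' hj hj', he' i j hi hi' hj hj', h]
  exact LinearMap.congr_fun₂ this x y

end Isomorphic

/-- The change of structure constants under a change of generators: an algebra with structure
constants `Q` with respect to `x`, `f` has the structure constants `P` with respect to `x + s f`,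
`d f`. The inequalities say that the new elements generate. -/
structure Params.Related (P Q : Params) (s d : ℂ) : Prop where
  d_ne_zero : d ≠ 0
  one_add_α_ne_zero : 1 + s * Q.α ≠ 0
  one_add_δ_ne_zero : 1 + s * Q.δ ≠ 0
  one_add_δ_sub_σ_ne_zero : 1 + s * (Q.δ - Q.σ) ≠ 0
  α_eq : Q.α * d = P.α * (1 + s * Q.α)
  δ_eq : Q.δ * d = P.δ * (1 + s * Q.δ)
  ν_eq : Q.ν + Q.σ * s = P.ν * (1 + s * (Q.δ - Q.σ))
  σ_eq : Q.σ * d = P.σ * (1 + s * (Q.δ - Q.σ))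
  β_eq : (Q.β + Q.δ * s) * d = P.α * s * (1 + Q.β + Q.δ * s) + P.β * d * (1 + s * Q.δ)

namespace IsStandardBasis

variable {L : Type*} [AddCommGroup L] [Module ℂ L] {n : ℕ} {P Q : Params}
  {b : L →ₗ[ℂ] L →ₗ[ℂ] L} {e e' : Module.Basis (Fin n) ℂ L} {x f : L}

theorem det_ne_zero (he : IsStandardBasis Q b e) (hn : 7 ≤ n)
    (hsplit : ∀ v, ∃ s t : ℂ, ∃ w, v = s • x + t • f + b w x) :
    coord e 1 x * coord e (n - 2) f - coord e (n - 2) x * coord e 1 f ≠ 0 := by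
  intro h0
  obtain ⟨s, t, w, h⟩ := hsplit (vec e 1)
  obtain ⟨s', t', w', h'⟩ := hsplit (vec e (n - 2))
  have h₁ := congrArg (coord e 1) h
  have h₂ := congrArg (coord e (n - 2)) h
  have h₁' := congrArg (coord e 1) h'
  have h₂' := congrArg (coord e (n - 2)) h'
  simp only [map_add, map_smul, he.coord_one_bracket hn, he.coord_bracket_sub_two hn, coord_vec,
    smul_eq_mul, add_zero, true_and] at h₁ h₂ h₁' h₂'
  rw [if_pos (by omega)] at h₁
  rw [if_pos (by omega)] at h₂'
  rw [if_neg (by omega)] at h₂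
  rw [if_neg (by omega)] at h₁'
  refine one_ne_zero (α := ℂ) ?_
  linear_combination (s' * coord e (n - 2) x + t' * coord e (n - 2) f) * h₁ + h₂' -
    (s' * coord e 1 x + t' * coord e 1 f) * h₂ + (s * t' - t * s') * h0

theorem exists_eq_bracket (he : IsStandardBasis Q b e) (hn : 7 ≤ n)
    (hsplit : ∀ v, ∃ s t : ℂ, ∃ w, v = s • x + t • f + b w x) {v : L}
    (h₁ : coord e 1 v = 0) (h₂ : coord e (n - 2) v = 0) : ∃ w, v = b w x := by
  have hdet := he.det_ne_zero hn hsplit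
  obtain ⟨s, t, w, rfl⟩ := hsplit v
  simp only [map_add, map_smul, he.coord_one_bracket hn, he.coord_bracket_sub_two hn,
    smul_eq_mul, add_zero] at h₁ h₂
  have hs : s = 0 := (mul_eq_zero.1 (show s * _ = 0 by
    linear_combination coord e (n - 2) f * h₁ - coord e 1 f * h₂)).resolve_right hdet
  have ht : t = 0 := (mul_eq_zero.1 (show t * _ = 0 by
    linear_combination coord e 1 x * h₂ - coord e (n - 2) x * h₁)).resolve_right hdet
  exact ⟨w, by rw [hs, ht, zero_smul, zero_smul, zero_add, zero_add]⟩

theorem exists_vec_eq_bracket (he : IsStandardBasis Q b e) (hn : 7 ≤ n)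
    (hsplit : ∀ v, ∃ s t : ℂ, ∃ w, v = s • x + t • f + b w x) {k : ℕ} (h₁ : k ≠ 1)
    (h₂ : k ≠ n - 2) : ∃ w, vec e k = b w x :=
  he.exists_eq_bracket hn hsplit (by rw [coord_vec, if_neg (by omega)])
    (by rw [coord_vec, if_neg (by omega)])

theorem coord_add_α_mul_ne_zero (he : IsStandardBasis Q b e) (hn : 7 ≤ n)
    (hsplit : ∀ v, ∃ s t : ℂ, ∃ w, v = s • x + t • f + b w x) :
    coord e 1 x + Q.α * coord e (n - 2) x ≠ 0 := by
  intro h0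
  obtain ⟨w, hw⟩ := he.exists_vec_eq_bracket hn hsplit (k := 2) (by omega) (by omega)
  have h := congrArg (coord e 2) hw
  rw [coord_vec, if_pos (by omega), he.coord_bracket_of_le hn (by omega), h0, mul_zero] at h
  exact one_ne_zero h

theorem coord_add_δ_mul_ne_zero (he : IsStandardBasis Q b e) (hn : 7 ≤ n)
    (hsplit : ∀ v, ∃ s t : ℂ, ∃ w, v = s • x + t • f + b w x) :
    coord e 1 x + Q.δ * coord e (n - 2) x ≠ 0 := by
  intro h0
  obtain ⟨w, hw⟩ := he.exists_vec_eq_bracket hn hsplit (k := n - 1) (by omega) (by omega)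
  have h₁ := congrArg (coord e 2) hw
  rw [coord_vec, if_neg (by omega), he.coord_bracket_of_le hn (by omega)] at h₁
  replace h₁ := (mul_eq_zero.1 h₁.symm).resolve_right (he.coord_add_α_mul_ne_zero hn hsplit)
  have h := congrArg (coord e (n - 1)) hw
  rw [coord_vec, if_pos (by omega), he.coord_bracket_sub_one hn, h₁] at h
  exact one_ne_zero (α := ℂ) (by linear_combination h + coord e (n - 2) w * h0)

theorem coord_add_δ_sub_σ_mul_ne_zero (he : IsStandardBasis Q b e) (hn : 7 ≤ n)
    (hsplit : ∀ v, ∃ s t : ℂ, ∃ w, v = s • x + t • f + b w x) :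
    coord e 1 x + (Q.δ - Q.σ) * coord e (n - 2) x ≠ 0 := by
  intro h0
  have hp := he.coord_add_α_mul_ne_zero hn hsplit
  obtain ⟨w, hw⟩ := he.exists_vec_eq_bracket hn hsplit (k := n) (by omega) (by omega)
  have h₁ := congrArg (coord e 2) hw
  rw [coord_vec, if_neg (by omega), he.coord_bracket_of_le hn (by omega)] at h₁
  replace h₁ := (mul_eq_zero.1 h₁.symm).resolve_right hp
  have h₂ := congrArg (coord e 3) hw
  rw [coord_vec, if_neg (by omega), he.coord_bracket_of_le hn (by omega)] at h₂
  replace h₂ : coord e 2 w = 0 := (mul_eq_zero.1 h₂.symm).resolve_right hp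
  have h₃ := congrArg (coord e (n - 1)) hw
  rw [coord_vec, if_neg (by omega), he.coord_bracket_sub_one hn, h₁] at h₃
  replace h₃ : coord e (n - 2) w = 0 :=
    (mul_eq_zero.1 (show coord e (n - 2) w * _ = 0 by linear_combination -h₃)).resolve_right
      (he.coord_add_δ_mul_ne_zero hn hsplit)
  have h := congrArg (coord e n) hw
  rw [coord_vec, if_pos (by omega), he.coord_bracket_last hn, h₁, h₂, h₃] at h
  exact one_ne_zero (α := ℂ) (by linear_combination h + coord e (n - 1) w * h0)

theorem coord_one_eq_zero (he : IsStandardBasis Q b e) (hn : 7 ≤ n)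
    (hsplit : ∀ v, ∃ s t : ℂ, ∃ w, v = s • x + t • f + b w x)
    (hf : b (b (b f x) x) x = 0) : coord e 1 f = 0 := by
  have h := congrArg (coord e 4) hf
  simp only [he.coord_bracket_of_le hn (show 4 ≤ n - 3 by omega), map_zero, Nat.reduceSub,
    he.coord_bracket_of_le hn (show 3 ≤ n - 3 by omega), mul_eq_zero,
    he.coord_bracket_of_le hn (show 2 ≤ n - 3 by omega),
    he.coord_add_α_mul_ne_zero hn hsplit, or_false] at h
  exact h

theorem related_of_relations (he : IsStandardBasis Q b e) (hn : 7 ≤ n)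
    (hsplit : ∀ v, ∃ s t : ℂ, ∃ w, v = s • x + t • f + b w x)
    (hf : b (b (b f x) x) x = 0) (hxf : b x f = P.α • b x x + P.β • b f x)
    (hff : b f f = P.δ • b f x) (hxf₂ : b x (b f x) = P.ν • b (b f x) x)
    (hff₂ : b f (b f x) = P.σ • b (b f x) x) :
    P.Related Q (coord e (n - 2) x / coord e 1 x) (coord e (n - 2) f / coord e 1 x) := by
  have hc := he.coord_one_eq_zero hn hsplit hf
  have hdet := he.det_ne_zero hn hsplit
  have hp := he.coord_add_α_mul_ne_zero hn hsplit
  have hq := he.coord_add_δ_mul_ne_zero hn hsplit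
  have hr := he.coord_add_δ_sub_σ_mul_ne_zero hn hsplit
  rw [hc, mul_zero, sub_zero] at hdet
  have ha := left_ne_zero_of_mul hdet
  have hd := right_ne_zero_of_mul hdet
  have r₁ := congrArg (coord e 2) hxf
  have r₂ := congrArg (coord e (n - 1)) hxf
  have r₃ := congrArg (coord e (n - 1)) hff
  have r₄ := congrArg (coord e n) hxf₂
  have r₅ := congrArg (coord e n) hff₂
  simp only [map_add, map_smul, smul_eq_mul, he.coord_bracket_of_le hn (show 2 ≤ n - 3 by omega),
    he.coord_bracket_sub_one hn, he.coord_bracket_last hn, he.coord_one_bracket hn,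
    he.coord_bracket_sub_two hn, Nat.reduceSub, hc] at r₁ r₂ r₃ r₄ r₅
  set a := coord e 1 x
  set s := coord e (n - 2) x
  set d := coord e (n - 2) f
  have hα : Q.α * d = P.α * (a + Q.α * s) := mul_left_cancel₀ ha (by linear_combination r₁)
  have hδ : Q.δ * d = P.δ * (a + Q.δ * s) := mul_left_cancel₀ hd (by linear_combination r₃)
  have hν : Q.ν * a + Q.σ * s = P.ν * (a + s * (Q.δ - Q.σ)) :=
    mul_left_cancel₀ (mul_ne_zero hd hq) (by linear_combination r₄)
  have hσ : Q.σ * d = P.σ * (a + s * (Q.δ - Q.σ)) :=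
    mul_left_cancel₀ (mul_ne_zero hd hq) (by linear_combination r₅)
  have hne {y : ℂ} (h : a + y * s ≠ 0) : 1 + s / a * y ≠ 0 := fun h0 => h <| by
    field_simp at h0
    linear_combination h0
  refine ⟨div_ne_zero hd ha, hne hp, hne hq, hne hr, ?_, ?_, ?_, ?_, ?_⟩ <;> field_simp
  · exact hα
  · exact hδ
  · exact hν
  · exact hσ
  · linear_combination r₂

theorem exists_related (he : IsStandardBasis Q b e) (he' : IsStandardBasis P b e') (hn : 7 ≤ n) :
    ∃ s d, P.Related Q s d := by
  have h₁ : b (vec e' (n - 2)) (vec e' 1) = vec e' (n - 1) := by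
    rw [he'.bracket_one (by omega) (by omega) (by omega), show n - 2 + 1 = n - 1 by omega]
  have h₂ : b (vec e' (n - 1)) (vec e' 1) = vec e' n := by
    rw [he'.bracket_one (by omega) (by omega) (by omega), show n - 1 + 1 = n by omega]
  refine ⟨_, _, he.related_of_relations hn (he'.isFirstTypeBasis hn).exists_eq_add_bracket
    ?_ ?_ ?_ ?_ ?_⟩
  · rw [h₁, h₂, (he'.isFirstTypeBasis hn).bracket_last (by omega) le_rfl (Or.inr rfl)]
  · rw [h₁, he'.bracket_one le_rfl (by omega) (by omega),
      he' _ _ (by omega) (by omega) (by omega) (by omega)]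
    grind [Params.table]
  all_goals
    simp only [h₁, h₂]
    rw [he' _ _ (by omega) (by omega) (by omega) (by omega)]
    grind [Params.table]

end IsStandardBasis

theorem Label.eq_of_related {p q : Label} (hp : p.Admissible) (hq : q.Admissible) {s d : ℂ}
    (h : p.params.Related q.params s d) : p = q := by
  obtain ⟨h1, h2, h3, h4, h5, h6, h7, h8, h9⟩ := h
  cases p <;> cases q <;> simp only [Label.params, Label.Admissible] at * <;> grind

section ChainGenerators

variable {L : Type*} [AddCommGroup L] [Module ℂ L] {n : ℕ} {b : L →ₗ[ℂ] L →ₗ[ℂ] L} {x f : L}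

/-- `x` and `f` generate the algebra under `R_x`, with chains of length at most `n - 3` and `3`. -/
structure ChainGenerators (n : ℕ) (b : L →ₗ[ℂ] L →ₗ[ℂ] L) (x f : L) : Prop where
  gen : ∀ S : Submodule ℂ L, x ∈ S → f ∈ S → (∀ u ∈ S, b u x ∈ S) → S = ⊤
  pow_x : (rightMul b x ^ (n - 3)) x = 0
  pow_f : (rightMul b x ^ 3) f = 0

/-- The vectors `x, [x,x], …` and `f, [f,x], [[f,x],x]` of the two chains, numbered `1, …, n`. -/
def chain (n : ℕ) (b : L →ₗ[ℂ] L →ₗ[ℂ] L) (x f : L) (k : ℕ) : L :=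
  if k ≤ n - 3 then (rightMul b x ^ (k - 1)) x else (rightMul b x ^ (k - (n - 2))) f

theorem chain_of_le {k : ℕ} (h : k ≤ n - 3) : chain n b x f k = (rightMul b x ^ (k - 1)) x :=
  if_pos h

theorem chain_sub_two (hn : 7 ≤ n) : chain n b x f (n - 2) = f := by
  rw [chain, if_neg (by omega), Nat.sub_self, pow_zero, Module.End.one_apply]

theorem chain_sub_one (hn : 7 ≤ n) : chain n b x f (n - 1) = b f x := by
  rw [chain, if_neg (by omega), show n - 1 - (n - 2) = 1 by omega, pow_one, rightMul_apply]

theorem chain_self (hn : 7 ≤ n) : chain n b x f n = b (b f x) x := by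
  rw [chain, if_neg (by omega), show n - (n - 2) = 1 + 1 by omega, rightMul_pow_succ, pow_one,
    rightMul_apply]

theorem chain_one (hn : 7 ≤ n) : chain n b x f 1 = x := by
  rw [chain_of_le (by omega), Nat.sub_self, pow_zero, Module.End.one_apply]

namespace ChainGenerators

theorem eq_top_of_pow_mem (h : ChainGenerators n b x f) {S : Submodule ℂ L}
    (hx : ∀ k, (rightMul b x ^ k) x ∈ S) (hf : ∀ k, (rightMul b x ^ k) f ∈ S) : S = ⊤ := by
  set T := Submodule.span ℂ (Set.range (fun k => (rightMul b x ^ k) x) ∪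
    Set.range fun k => (rightMul b x ^ k) f)
  have hT : T ≤ T.comap (rightMul b x) := Submodule.span_le.2 <| by
    rintro _ (⟨k, rfl⟩ | ⟨k, rfl⟩)
    · exact Submodule.subset_span (Or.inl ⟨k + 1, rightMul_pow_succ b x x k⟩)
    · exact Submodule.subset_span (Or.inr ⟨k + 1, rightMul_pow_succ b x f k⟩)
  rw [eq_top_iff, ← h.gen T (Submodule.subset_span (Or.inl ⟨0, rfl⟩))
    (Submodule.subset_span (Or.inr ⟨0, rfl⟩)) fun u hu => hT hu, Submodule.span_le]
  rintro _ (⟨k, rfl⟩ | ⟨k, rfl⟩)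
  · exact hx k
  · exact hf k

theorem pow_x_of_le (h : ChainGenerators n b x f) {k : ℕ} (hk : n - 3 ≤ k) :
    (rightMul b x ^ k) x = 0 := by
  obtain ⟨j, rfl⟩ := Nat.exists_eq_add_of_le' hk
  rw [pow_add, Module.End.mul_apply, h.pow_x, map_zero]

theorem pow_f_of_le (h : ChainGenerators n b x f) {k : ℕ} (hk : 3 ≤ k) :
    (rightMul b x ^ k) f = 0 := by
  obtain ⟨j, rfl⟩ := Nat.exists_eq_add_of_le' hk
  rw [pow_add, Module.End.mul_apply, h.pow_f, map_zero]

theorem bracket_bracket_bracket_f (h : ChainGenerators n b x f) : b (b (b f x) x) x = 0 :=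
  h.pow_f

theorem bracket_chain_x (h : ChainGenerators n b x f) (hn : 7 ≤ n) {i : ℕ} (hi : 1 ≤ i)
    (hi' : i ≤ n) : b (chain n b x f i) x =
      if i ≤ n - 1 ∧ i ≠ n - 3 then chain n b x f (i + 1) else 0 := by
  obtain hi'' | rfl | rfl | rfl | rfl :
      i < n - 3 ∨ i = n - 3 ∨ i = n - 2 ∨ i = n - 1 ∨ n = i := by omega
  · rw [if_pos (by omega), chain_of_le hi''.le, chain_of_le hi'', ← rightMul_pow_succ,
      show i - 1 + 1 = i + 1 - 1 by omega]
  · rw [if_neg (by omega), chain_of_le le_rfl, ← rightMul_pow_succ, h.pow_x_of_le (by omega)]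
  · rw [if_pos (by omega), chain_sub_two hn, show n - 2 + 1 = n - 1 by omega, chain_sub_one hn]
  · rw [if_pos (by omega), chain_sub_one hn, show n - 1 + 1 = n by omega, chain_self hn]
  · rw [if_neg (by omega), chain_self hn, h.bracket_bracket_bracket_f]

theorem exists_basis_eq_chain (h : ChainGenerators n b x f) (hn : 7 ≤ n)
    (hdim : Module.finrank ℂ L = n) :
    ∃ e : Module.Basis (Fin n) ℂ L, ∀ k, 1 ≤ k → k ≤ n → vec e k = chain n b x f k := by
  have hspan : ⊤ ≤ Submodule.span ℂ (Set.range fun i : Fin n => chain n b x f (i + 1)) := by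
    refine (h.eq_top_of_pow_mem (fun k => ?_) fun k => ?_).ge
    · by_cases hk : k < n - 3
      · exact Submodule.subset_span ⟨⟨k, by omega⟩, chain_of_le hk⟩
      · exact h.pow_x_of_le (not_lt.1 hk) ▸ zero_mem _
    · by_cases hk : k < 3
      · refine Submodule.subset_span ⟨⟨k + (n - 3), by omega⟩, ?_⟩
        simp only [chain, if_neg (show ¬ k + (n - 3) + 1 ≤ n - 3 by omega),
          show k + (n - 3) + 1 - (n - 2) = k by omega]
      · exact h.pow_f_of_le (not_lt.1 hk) ▸ zero_mem _
  refine ⟨basisOfTopLeSpanOfCardEqFinrank _ hspan (by rw [Fintype.card_fin, hdim]),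
    fun k hk hk' => ?_⟩
  obtain ⟨i, rfl, hi⟩ := exists_vec_eq (basisOfTopLeSpanOfCardEqFinrank _ hspan
    (by rw [Fintype.card_fin, hdim])) hk hk'
  rw [hi, coe_basisOfTopLeSpanOfCardEqFinrank]

end ChainGenerators

end ChainGenerators

section LeibnizIdentity

variable {L : Type*} [AddCommGroup L] [Module ℂ L] {b : L →ₗ[ℂ] L →ₗ[ℂ] L}

theorem IsLeibniz.bracket_bracket_comm (hb : IsLeibniz b) (u x v : L) :
    b (b u x) v = b (b u v) x - b u (b v x) := by
  rw [hb u v x, sub_sub_cancel]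

theorem IsLeibniz.bracket_eq_zero_of_chain (hb : IsLeibniz b) {X : ℕ → L}
    (hX : ∀ k, b (X k) (X 0) = X (k + 1)) (u : L) (k : ℕ) : b u (X (k + 1)) = 0 := by
  induction k generalizing u with
  | zero => rw [← hX, hb, sub_self]
  | succ k ih => rw [← hX, hb, ih, ih, map_zero, LinearMap.zero_apply, sub_self]

theorem IsLeibniz.bracket_pow_succ (hb : IsLeibniz b) (u x : L) (k : ℕ) :
    b u ((rightMul b x ^ (k + 1)) x) = 0 :=
  hb.bracket_eq_zero_of_chain (fun k => (rightMul_pow_succ b x x k).symm) u k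

end LeibnizIdentity

section Presentation

variable {L : Type*} [AddCommGroup L] [Module ℂ L] {n : ℕ} {P Q : Params}
  {b : L →ₗ[ℂ] L →ₗ[ℂ] L} {x f : L}

/-- Two chain generators of a Leibniz algebra whose products are given by the structure
constants `P`. -/
structure Presentation (n : ℕ) (b : L →ₗ[ℂ] L →ₗ[ℂ] L) (x f : L) (P : Params) : Prop
    extends ChainGenerators n b x f where
  leibniz : IsLeibniz b
  bracket_x_f : b x f = P.α • b x x + P.β • b f x
  bracket_f_f : b f f = P.δ • b f x
  bracket_x_f₂ : b x (b f x) = P.ν • b (b f x) x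
  bracket_f_f₂ : b f (b f x) = P.σ • b (b f x) x
  bracket_f₃ : ∀ u, b u (b (b f x) x) = 0

namespace Presentation

theorem bracket_bracket_f (h : Presentation n b x f P) (u : L) :
    b (b u x) f = b (b u f) x - b u (b f x) :=
  h.leibniz.bracket_bracket_comm u x f

theorem bracket_bracket_f₂ (h : Presentation n b x f P) (u : L) :
    b (b u x) (b f x) = b (b u (b f x)) x := by
  rw [h.leibniz.bracket_bracket_comm, h.bracket_f₃, sub_zero]

theorem bracket_x₂_f (h : Presentation n b x f P) :
    b (b x x) f = P.α • b (b x x) x + (P.β - P.ν) • b (b f x) x := by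
  rw [h.bracket_bracket_f, h.bracket_x_f, h.bracket_x_f₂, map_add, map_smul, map_smul,
    LinearMap.add_apply, LinearMap.smul_apply, LinearMap.smul_apply, sub_smul, add_sub_assoc]

theorem bracket_f₂_f (h : Presentation n b x f P) :
    b (b f x) f = (P.δ - P.σ) • b (b f x) x := by
  rw [h.bracket_bracket_f, h.bracket_f_f, h.bracket_f_f₂, map_smul, LinearMap.smul_apply, sub_smul]

theorem bracket_f₂_f₂ (h : Presentation n b x f P) : b (b f x) (b f x) = 0 := by
  rw [h.bracket_bracket_f₂, h.bracket_f_f₂, map_smul, LinearMap.smul_apply,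
    h.bracket_bracket_bracket_f, smul_zero]

theorem bracket_f₃_f₂ (h : Presentation n b x f P) : b (b (b f x) x) (b f x) = 0 := by
  rw [h.bracket_bracket_f₂, h.bracket_f₂_f₂, map_zero, LinearMap.zero_apply]

theorem bracket_f₃_f (h : Presentation n b x f P) : b (b (b f x) x) f = 0 := by
  rw [h.bracket_bracket_f, h.bracket_f₂_f, h.bracket_f₂_f₂, map_smul, LinearMap.smul_apply,
    h.bracket_bracket_bracket_f, smul_zero, sub_zero]

theorem bracket_pow_succ_f₂ (h : Presentation n b x f P) (k : ℕ) :
    b ((rightMul b x ^ (k + 1)) x) (b f x) = 0 := by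
  induction k with
  | zero =>
    rw [rightMul_pow_succ, h.bracket_bracket_f₂, pow_zero, Module.End.one_apply, h.bracket_x_f₂,
      map_smul, LinearMap.smul_apply, h.bracket_bracket_bracket_f, smul_zero]
  | succ k ih =>
    rw [rightMul_pow_succ, h.bracket_bracket_f₂, ih, map_zero, LinearMap.zero_apply]

theorem bracket_pow_add_two_f (h : Presentation n b x f P) (k : ℕ) :
    b ((rightMul b x ^ (k + 2)) x) f = P.α • (rightMul b x ^ (k + 3)) x := by
  induction k with
  | zero =>
    rw [rightMul_pow_succ, h.bracket_bracket_f, h.bracket_pow_succ_f₂ 0, sub_zero,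
      rightMul_pow_succ, pow_zero, Module.End.one_apply, h.bracket_x₂_f, map_add, map_smul,
      map_smul, LinearMap.add_apply, LinearMap.smul_apply, LinearMap.smul_apply,
      h.bracket_bracket_bracket_f, smul_zero, add_zero]
    rfl
  | succ k ih =>
    rw [rightMul_pow_succ, h.bracket_bracket_f, ih, h.bracket_pow_succ_f₂ (k + 1),
      rightMul_pow_succ b x x (k + 3), map_smul, LinearMap.smul_apply, sub_zero]

theorem bracket_chain_f (h : Presentation n b x f P) (hn : 7 ≤ n) {i : ℕ} (hi : 1 ≤ i)
    (hi' : i ≤ n) : b (chain n b x f i) f = P.table n (chain n b x f) i (n - 2) := by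
  have h₂ : chain n b x f 2 = b x x := chain_of_le (by omega)
  have h₃ : chain n b x f 3 = b (b x x) x := chain_of_le (by omega)
  have hs (k : ℕ) (hk : k + 3 ≤ n - 3) :
      b (chain n b x f (k + 3)) f = P.α • (rightMul b x ^ (k + 3)) x := by
    rw [chain_of_le hk, ← h.bracket_pow_add_two_f]
    rfl
  obtain rfl | rfl | ⟨k, rfl, hk⟩ | rfl | rfl | rfl | rfl : i = 1 ∨ i = 2 ∨
      (∃ k, i = k + 3 ∧ k + 3 ≤ n - 4) ∨ i = n - 3 ∨ i = n - 2 ∨ i = n - 1 ∨ n = i := by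
    by_cases h3 : 3 ≤ i ∧ i ≤ n - 4
    · exact Or.inr (Or.inr (Or.inl ⟨i - 3, by omega, by omega⟩))
    · omega
  · rw [chain_one hn, h.bracket_x_f]
    grind [Params.table, chain_sub_one]
  · rw [h₂, h.bracket_x₂_f]
    grind [Params.table, chain_self]
  · rw [hs k (by omega)]
    grind [Params.table, chain_of_le]
  · have := hs (n - 6) (by omega)
    rw [show n - 6 + 3 = n - 3 by omega, h.pow_x, smul_zero] at this
    grind [Params.table]
  · rw [chain_sub_two hn, h.bracket_f_f]
    grind [Params.table, chain_sub_one]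
  · rw [chain_sub_one hn, h.bracket_f₂_f]
    grind [Params.table, chain_self]
  · rw [chain_self hn, h.bracket_f₃_f]
    grind [Params.table]

theorem bracket_chain_f₂ (h : Presentation n b x f P) (hn : 7 ≤ n) {i : ℕ} (hi : 1 ≤ i)
    (hi' : i ≤ n) : b (chain n b x f i) (b f x) = P.table n (chain n b x f) i (n - 1) := by
  obtain rfl | hi'' | rfl | rfl | rfl :
      i = 1 ∨ (2 ≤ i ∧ i ≤ n - 3) ∨ i = n - 2 ∨ i = n - 1 ∨ n = i := by omega
  · rw [chain_one hn, h.bracket_x_f₂]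
    grind [Params.table, chain_self]
  · rw [chain_of_le hi''.2, show i - 1 = i - 2 + 1 by omega, h.bracket_pow_succ_f₂]
    grind [Params.table]
  · rw [chain_sub_two hn, h.bracket_f_f₂]
    grind [Params.table, chain_self]
  · rw [chain_sub_one hn, h.bracket_f₂_f₂]
    grind [Params.table]
  · rw [chain_self hn, h.bracket_f₃_f₂]
    grind [Params.table]

theorem bracket_chain (h : Presentation n b x f P) (hn : 7 ≤ n) {i j : ℕ} (hi : 1 ≤ i)
    (hi' : i ≤ n) (hj : 1 ≤ j) (hj' : j ≤ n) :
    b (chain n b x f i) (chain n b x f j) = P.table n (chain n b x f) i j := by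
  obtain rfl | hj'' | rfl | rfl | rfl :
      j = 1 ∨ (2 ≤ j ∧ j ≤ n - 3) ∨ j = n - 2 ∨ j = n - 1 ∨ n = j := by omega
  · rw [chain_one hn, h.bracket_chain_x hn hi hi']
    grind [Params.table]
  · rw [chain_of_le hj''.2, show j - 1 = j - 2 + 1 by omega, h.leibniz.bracket_pow_succ]
    grind [Params.table]
  · rw [chain_sub_two hn, h.bracket_chain_f hn hi hi']
  · rw [chain_sub_one hn, h.bracket_chain_f₂ hn hi hi']
  · rw [chain_self hn, h.bracket_f₃]
    grind [Params.table]

theorem exists_isStandardBasis (h : Presentation n b x f P) (hn : 7 ≤ n)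
    (hdim : Module.finrank ℂ L = n) :
    ∃ e : Module.Basis (Fin n) ℂ L, IsStandardBasis P b e := by
  obtain ⟨e, he⟩ := h.exists_basis_eq_chain hn hdim
  refine ⟨e, fun i j hi hi' hj hj' => ?_⟩
  rw [he i hi hi', he j hj hj', h.bracket_chain hn hi hi' hj hj']
  grind [Params.table]

end Presentation

end Presentation

namespace Presentation

variable {L : Type*} [AddCommGroup L] [Module ℂ L] {n : ℕ} {P Q : Params}
  {b : L →ₗ[ℂ] L →ₗ[ℂ] L} {x f : L} {s d : ℂ}

section ChangedBrackets

variable (h : Presentation n b x f Q) (s)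
include h

theorem bracket_x_changed :
    b x (x + s • f) = (1 + s * Q.α) • b x x + (s * Q.β) • b f x := by
  rw [map_add, map_smul, h.bracket_x_f]
  module

theorem bracket_x₂_changed : b (b x x) (x + s • f) =
    (1 + s * Q.α) • b (b x x) x + (s * (Q.β - Q.ν)) • b (b f x) x := by
  rw [map_add, map_smul, h.bracket_x₂_f]
  module

theorem bracket_pow_add_two_changed (k : ℕ) : b ((rightMul b x ^ (k + 2)) x) (x + s • f) =
    (1 + s * Q.α) • (rightMul b x ^ (k + 3)) x := by
  rw [map_add, map_smul, h.bracket_pow_add_two_f, rightMul_pow_succ b x x (k + 2)]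
  module

theorem bracket_f_changed : b f (x + s • f) = (1 + s * Q.δ) • b f x := by
  rw [map_add, map_smul, h.bracket_f_f]
  module

theorem bracket_f₂_changed :
    b (b f x) (x + s • f) = (1 + s * (Q.δ - Q.σ)) • b (b f x) x := by
  rw [map_add, map_smul, h.bracket_f₂_f]
  module

theorem bracket_f₃_changed : b (b (b f x) x) (x + s • f) = 0 := by
  rw [map_add, map_smul, h.bracket_f₃_f, h.bracket_bracket_bracket_f, smul_zero, add_zero]

end ChangedBrackets

theorem eq_top_of_changed_mem (h : Presentation n b x f Q) (hr : P.Related Q s d)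
    {S : Submodule ℂ L} (hx : x + s • f ∈ S) (hf : d • f ∈ S)
    (hS : ∀ u ∈ S, b u (x + s • f) ∈ S) : S = ⊤ := by
  replace hf : f ∈ S := (S.smul_mem_iff hr.d_ne_zero).1 hf
  have hf₂ : b f x ∈ S := (S.smul_mem_iff hr.one_add_δ_ne_zero).1 (h.bracket_f_changed s ▸ hS _ hf)
  have hf₃ : b (b f x) x ∈ S :=
    (S.smul_mem_iff hr.one_add_δ_sub_σ_ne_zero).1 (h.bracket_f₂_changed s ▸ hS _ hf₂)
  replace hx : x ∈ S := (S.add_mem_iff_left (S.smul_mem s hf)).1 hx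
  have hx₂ : b x x ∈ S := (S.smul_mem_iff hr.one_add_α_ne_zero).1 <|
    (S.add_mem_iff_left (S.smul_mem _ hf₂)).1 (h.bracket_x_changed s ▸ hS _ hx)
  have hx₃ : b (b x x) x ∈ S := (S.smul_mem_iff hr.one_add_α_ne_zero).1 <|
    (S.add_mem_iff_left (S.smul_mem _ hf₃)).1 (h.bracket_x₂_changed s ▸ hS _ hx₂)
  have hxk (k : ℕ) : (rightMul b x ^ (k + 2)) x ∈ S := by
    induction k with
    | zero => exact hx₃
    | succ k ih =>
      exact (S.smul_mem_iff hr.one_add_α_ne_zero).1 (h.bracket_pow_add_two_changed s k ▸ hS _ ih)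
  refine h.eq_top_of_pow_mem (fun k => ?_) fun k => ?_
  · match k with
    | 0 => exact hx
    | 1 => exact hx₂
    | k + 2 => exact hxk k
  · match k with
    | 0 => exact hf
    | 1 => exact hf₂
    | 2 => exact hf₃
    | k + 3 => exact h.pow_f_of_le (Nat.le_add_left 3 k) ▸ zero_mem S

theorem change_generators (h : Presentation n b x f Q) (hn : 7 ≤ n)
    (hdim : Module.finrank ℂ L = n) (hr : P.Related Q s d) :
    Presentation n b (x + s • f) (d • f) P := by
  have hf₂ : b (d • f) (x + s • f) = (d * (1 + s * Q.δ)) • b f x := by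
    rw [map_smul, LinearMap.smul_apply, h.bracket_f_changed, smul_smul]
  have hf₃ : b (b (d • f) (x + s • f)) (x + s • f) =
      (d * (1 + s * Q.δ) * (1 + s * (Q.δ - Q.σ))) • b (b f x) x := by
    rw [hf₂, map_smul, LinearMap.smul_apply, h.bracket_f₂_changed, smul_smul]
  have hx₂ : b (x + s • f) (x + s • f) =
      (1 + s * Q.α) • b x x + (s * (1 + Q.β + Q.δ * s)) • b f x := by
    rw [map_add b, LinearMap.add_apply, map_smul b, LinearMap.smul_apply, h.bracket_x_changed,
      h.bracket_f_changed]
    module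
  refine ⟨⟨fun S => h.eq_top_of_changed_mem hr, ?_, ?_⟩, h.leibniz, ?_, ?_, ?_, ?_, fun u => ?_⟩
  · obtain ⟨e, he⟩ := h.exists_isStandardBasis hn hdim
    have hmem := rightMul_pow_mem_lcs b (x + s • f) (x + s • f) (n - 3)
    rwa [(he.isWeightBasis hn).lcs_eq_bot (chainWeight_lt hn), Submodule.mem_bot] at hmem
  · change b (b (b (d • f) (x + s • f)) (x + s • f)) (x + s • f) = 0
    rw [hf₃, map_smul, LinearMap.smul_apply, h.bracket_f₃_changed, smul_zero]
  · rw [hf₂, hx₂, map_smul, map_add, LinearMap.add_apply, map_smul, LinearMap.smul_apply,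
      h.bracket_x_f, h.bracket_f_f]
    linear_combination (norm := module) hr.α_eq • b x x + hr.β_eq • b f x
  · rw [hf₂, map_smul, map_smul, LinearMap.smul_apply, h.bracket_f_f]
    linear_combination (norm := module) (d * hr.δ_eq) • b f x
  · rw [hf₃, hf₂, map_smul, map_add, LinearMap.add_apply, map_smul, LinearMap.smul_apply,
      h.bracket_x_f₂, h.bracket_f_f₂]
    linear_combination (norm := module) (d * (1 + s * Q.δ) * hr.ν_eq) • b (b f x) x
  · rw [hf₃, hf₂, map_smul, map_smul, LinearMap.smul_apply, h.bracket_f_f₂]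
    linear_combination (norm := module) (d * (1 + s * Q.δ) * hr.σ_eq) • b (b f x) x
  · rw [hf₃, map_smul, h.bracket_f₃, smul_zero]

end Presentation

section Normalization

/-- Some listed algebra arises from the structure constants `Q` by a change of generators. -/
def Params.Normalizes (Q : Params) : Prop :=
  ∃ p : Label, p.Admissible ∧ ∃ s d, p.params.Related Q s d

theorem normalizes_a34 (β : ℂ) : Params.Normalizes ⟨0, β, 0, 0, 0⟩ :=
  ⟨.a34 β, trivial, 0, 1, by constructor <;> simp [Label.params]⟩

theorem normalizes_a35_zero (β : ℂ) {δ : ℂ} (hδ : δ ≠ 0) : Params.Normalizes ⟨0, β, δ, 0, 0⟩ := by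
  by_cases hβ : β = 1
  · exact ⟨.a35 0 1, by simp [Label.Admissible], 0, 1 / δ, by
      constructor <;> simp [Label.params, hδ, hβ]⟩
  · have hβ' : 1 - β ≠ 0 := sub_ne_zero.2 (Ne.symm hβ)
    exact ⟨.a35 0 0, by simp [Label.Admissible], -β / δ, (1 - β) / δ, by
      constructor <;> (try simp only [Label.params]) <;> (try field_simp) <;> grind⟩

theorem normalizes_a36 {α : ℂ} (hα : α ≠ 0) (β : ℂ) : Params.Normalizes ⟨α, β, 0, 0, 0⟩ := by
  by_cases hβ : β = -1
  · exact ⟨.a36 (-1), by simp [Label.Admissible], 0, 1 / α, by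
      constructor <;> simp [Label.params, hα, hβ]⟩
  · have hβ' : 1 + β ≠ 0 := fun h => hβ (by linear_combination h)
    exact ⟨.a36 0, by simp [Label.Admissible], β / α, (1 + β) / α, by
      constructor <;> (try simp only [Label.params]) <;> (try field_simp) <;> grind⟩

theorem normalizes_a35_one {α : ℂ} (hα : α ≠ 0) (β : ℂ) : Params.Normalizes ⟨α, β, α, 0, 0⟩ := by
  by_cases hβ : β = 0
  · exact ⟨.a35 1 0, by simp [Label.Admissible], 0, 1 / α, by
      constructor <;> simp [Label.params, hα, hβ]⟩
  · obtain ⟨t, ht⟩ := IsAlgClosed.exists_pow_nat_eq β (n := 2) two_pos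
    have ht0 : t ≠ 0 := fun h => hβ (by rw [← ht, h, zero_pow two_ne_zero])
    exact ⟨.a35 1 1, by simp [Label.Admissible], (t - 1) / α, t / α, by
      constructor <;> (try simp only [Label.params]) <;> (try field_simp) <;> grind⟩

theorem normalizes_a37 {α δ : ℂ} (hα : α ≠ 0) (hδ : δ ≠ 0) (hαδ : α ≠ δ) (β : ℂ) :
    Params.Normalizes ⟨α, β, δ, 0, 0⟩ := by
  -- `s` and `d` solve `α d = 1 + s α` and `δ d = 2 (1 + s δ)`
  obtain ⟨s, d, hd, hp, hq⟩ :
      ∃ s d : ℂ, d ≠ 0 ∧ 1 + s * α = α * d ∧ 2 * (1 + s * δ) = δ * d := by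
    refine ⟨(δ - 2 * α) / (α * δ), 2 * (δ - α) / (α * δ), ?_, by field_simp; ring,
      by field_simp; ring⟩
    exact div_ne_zero (mul_ne_zero two_ne_zero (sub_ne_zero.2 hαδ.symm)) (mul_ne_zero hα hδ)
  have hq0 : 1 + s * δ ≠ 0 := right_ne_zero_of_mul (hq ▸ mul_ne_zero hδ hd)
  refine ⟨.a37 (((β + δ * s) * d - s * (1 + β + δ * s)) / (d * (1 + s * δ))), trivial, s, d, ?_⟩
  refine ⟨hd, ?_, ?_, ?_, ?_, ?_, ?_, ?_, ?_⟩ <;> simp only [Label.params]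
  · exact hp ▸ mul_ne_zero hα hd
  · exact hq0
  · rwa [sub_zero]
  · rw [one_mul, hp]
  · rw [hq]
  · ring
  · ring
  · linear_combination
      -div_mul_cancel₀ ((β + δ * s) * d - s * (1 + β + δ * s)) (mul_ne_zero hd hq0)

theorem normalizes_a38_a40_zero (α : ℂ) {ν : ℂ} (hν : ν ≠ 0) :
    Params.Normalizes ⟨α, -1, 0, ν, 0⟩ := by
  by_cases hα : α = 0
  · exact ⟨.a38 ν, hν, 0, 1, by constructor <;> simp [Label.params, hα]⟩
  · exact ⟨.a40 0 ν, Or.inl ⟨rfl, hν⟩, 0, 1 / α, by constructor <;> simp [Label.params, hα]⟩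

theorem normalizes_a39 (ν : ℂ) {σ : ℂ} (hσ : σ ≠ 0) : Params.Normalizes ⟨0, -1, 0, ν, σ⟩ := by
  by_cases hν : ν = -1
  · exact ⟨.a39 (-1), Or.inl rfl, 0, 1 / σ, by constructor <;> simp [Label.params, hσ, hν]⟩
  · have hν' : 1 + ν ≠ 0 := fun h => hν (by linear_combination h)
    exact ⟨.a39 0, Or.inr rfl, -ν / σ, (1 + ν) / σ, by
      constructor <;> (try simp only [Label.params]) <;> (try field_simp) <;> grind⟩

theorem normalizes_a41 {α : ℂ} (hα : α ≠ 0) (ν : ℂ) : Params.Normalizes ⟨α, -1, 0, ν, -α⟩ := by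
  by_cases hν : ν = -1
  · exact ⟨.a41 (-1), Or.inl rfl, 0, 1 / α, by constructor <;> simp [Label.params, hα, hν]⟩
  · have hν' : 1 + ν ≠ 0 := fun h => hν (by linear_combination h)
    exact ⟨.a41 0, Or.inr rfl, ν / α, (1 + ν) / α, by
      constructor <;> (try simp only [Label.params]) <;> (try field_simp) <;> grind⟩

theorem normalizes_a40_one {α σ : ℂ} (hα : α ≠ 0) (hσ : σ ≠ 0) (hασ : α + σ ≠ 0) (ν : ℂ) :
    Params.Normalizes ⟨α, -1, 0, ν, σ⟩ := by
  -- `s` and `d` solve `α d = 1 + s α` and `σ d = 1 - s σ`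
  obtain ⟨s, d, hd, hp, hr⟩ :
      ∃ s d : ℂ, d ≠ 0 ∧ 1 + s * α = α * d ∧ 1 + s * (0 - σ) = σ * d := by
    refine ⟨(α - σ) / (2 * α * σ), (α + σ) / (2 * α * σ), ?_, by field_simp; ring,
      by field_simp; ring⟩
    exact div_ne_zero hασ (mul_ne_zero (mul_ne_zero two_ne_zero hα) hσ)
  have hr0 : 1 + s * (0 - σ) ≠ 0 := hr ▸ mul_ne_zero hσ hd
  refine ⟨.a40 1 ((ν + σ * s) / (1 + s * (0 - σ))), Or.inr rfl, s, d, ?_⟩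
  refine ⟨hd, ?_, ?_, ?_, ?_, ?_, ?_, ?_, ?_⟩ <;> simp only [Label.params]
  · exact hp ▸ mul_ne_zero hα hd
  · rw [mul_zero, add_zero]
    exact one_ne_zero
  · exact hr0
  · rw [one_mul, hp]
  · ring
  · exact (div_mul_cancel₀ _ hr0).symm
  · rw [one_mul, hr]
  · ring

theorem Params.Good.normalizes {Q : Params} (hQ : Q.Good) : Q.Normalizes := by
  obtain ⟨α, β, δ, ν, σ⟩ := Q
  obtain ⟨h1, h2, h3, h4⟩ := hQ
  by_cases hνσ : ν = 0 ∧ σ = 0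
  · obtain ⟨rfl, rfl⟩ := hνσ
    rcases eq_or_ne δ 0 with rfl | hδ
    · rcases eq_or_ne α 0 with rfl | hα
      exacts [normalizes_a34 β, normalizes_a36 hα β]
    · rcases eq_or_ne α 0 with rfl | hα
      · exact normalizes_a35_zero β hδ
      rcases eq_or_ne α δ with rfl | hαδ
      exacts [normalizes_a35_one hα β, normalizes_a37 hα hδ hαδ β]
  · obtain ⟨rfl, rfl⟩ : δ = 0 ∧ β = -1 := by grind
    rcases eq_or_ne σ 0 with rfl | hσ
    · exact normalizes_a38_a40_zero α fun h => hνσ ⟨h, rfl⟩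
    rcases eq_or_ne α 0 with rfl | hα
    · exact normalizes_a39 ν hσ
    by_cases hασ : α + σ = 0
    · obtain rfl : σ = -α := eq_neg_of_add_eq_zero_right hασ
      exact normalizes_a41 hα ν
    · exact normalizes_a40_one hα hσ hασ ν

end Normalization

section HomogeneousGenerators

theorem eq_top_of_sup_range_eq_top {L : Type*} [AddCommGroup L] [Module ℂ L] {A : L →ₗ[ℂ] L}
    {m : ℕ} (hA : A ^ m = 0) {S : Submodule ℂ L} (hS : S ≤ S.comap A)
    (h : S ⊔ LinearMap.range A = ⊤) : S = ⊤ := by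
  have hpow : ∀ k, S ⊔ LinearMap.range (A ^ k) = ⊤ := by
    intro k
    induction k with
    | zero => rw [pow_zero, Module.End.one_eq_id, LinearMap.range_id, sup_top_eq]
    | succ k ih =>
      have hk : LinearMap.range (A ^ k) ≤ S ⊔ LinearMap.range (A ^ (k + 1)) := by
        rw [LinearMap.range_eq_map, ← h, Submodule.map_sup, pow_succ, Module.End.mul_eq_comp,
          LinearMap.range_comp]
        exact sup_le_sup_right (Submodule.map_le_iff_le_comap.2 (S.le_comap_pow_of_le_comap hS k)) _
      exact top_unique (ih.ge.trans (sup_le le_sup_left hk))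
  simpa [hA] using hpow m

variable {L : Type*} [AddCommGroup L] [Module ℂ L] {n : ℕ} {b : L →ₗ[ℂ] L →ₗ[ℂ] L}
  {D : L →ₗ[ℂ] L} {x f : L}

/-- Chain generators of weight one for a grading derivation `D`. -/
structure HomogeneousGenerators (n : ℕ) (b : L →ₗ[ℂ] L →ₗ[ℂ] L) (D : L →ₗ[ℂ] L) (x f : L) : Prop
    extends ChainGenerators n b x f where
  leibniz : IsLeibniz b
  isGradingDerivation : IsGradingDerivation b D
  map_x : D x = x
  map_f : D f = f

namespace IsFirstTypeBasis

variable {e : Module.Basis (Fin n) ℂ L}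

theorem exists_isGradingDerivation (he : IsFirstTypeBasis b e) (hb : IsNaturallyGraded b) :
    ∃ D, IsGradingDerivation b D ∧ D (vec e 1) - vec e 1 ∈ LinearMap.ker b.flip := by
  obtain ⟨D, hD⟩ := hb.exists_isGradingDerivation
  obtain ⟨hL, hnil, -⟩ := hb
  obtain ⟨w, hw⟩ := he.derived_le_range hL hnil
    (by simpa using hD.sub_mem_lcs 0 (vec e 1) Submodule.mem_top)
  refine ⟨D + rightMul b w, hD.add_rightMul hL w, ?_⟩
  -- `[w, e₁] + [e₁, w]` lies in the right annihilator
  ext y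
  rw [LinearMap.add_apply, rightMul_apply, add_sub_right_comm, ← hw, rightMul_apply,
    LinearMap.flip_apply, map_add, hL, hL, LinearMap.zero_apply]
  abel

theorem chainGenerators (he : IsFirstTypeBasis b e) (hn : 6 ≤ n)
    (hR : rightMul b x = rightMul b (vec e 1))
    (hx : x - vec e 1 ∈ LinearMap.range (rightMul b (vec e 1)))
    (hf : f - vec e (n - 2) ∈ LinearMap.range (rightMul b (vec e 1)))
    (hf₃ : (rightMul b x ^ 3) f = 0) : ChainGenerators n b x f where
  gen S hxS hfS hS := by
    rw [← hR] at hx hf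
    have mem_sup {u v : L} (hu : u ∈ S) (h : u - v ∈ LinearMap.range (rightMul b x)) :
        v ∈ S ⊔ LinearMap.range (rightMul b x) :=
      sub_sub_cancel u v ▸ sub_mem (Submodule.mem_sup_left hu) (Submodule.mem_sup_right h)
    refine eq_top_of_sup_range_eq_top (A := rightMul b x) (hR ▸ he.pow_eq_zero hn) hS
      (top_unique fun v _ => ?_)
    obtain ⟨s, t, w, rfl⟩ := he.exists_eq_add_bracket v
    refine add_mem (add_mem (Submodule.smul_mem _ s (mem_sup hxS hx))
      (Submodule.smul_mem _ t (mem_sup hfS hf))) (Submodule.mem_sup_right ⟨w, ?_⟩)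
    rw [hR, rightMul_apply]
  pow_x := by rw [hR, he.pow_eq_zero hn, LinearMap.zero_apply]
  pow_f := hf₃

theorem exists_homogeneousGenerators (he : IsFirstTypeBasis b e) (hn : 6 ≤ n)
    (hb : IsNaturallyGraded b) :
    ∃ D x f, HomogeneousGenerators n b D x f ∧ rightMul b x = rightMul b (vec e 1) := by
  obtain ⟨D, hD, hDe⟩ := he.exists_isGradingDerivation hb
  obtain ⟨hL, hnil, -⟩ := hb
  have hsub (u : L) : D u - u ∈ lcs b 1 := by simpa using hD.sub_mem_lcs 0 u Submodule.mem_top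
  obtain ⟨x, hDx, hx⟩ := hD.exists_eq_self hnil (S := lcs b 1 ⊓ LinearMap.ker b.flip)
    (fun r hr => ⟨hD.map_mem_lcs hr.1, hD.map_mem_ker_flip hr.2⟩) ⟨hsub (vec e 1), hDe⟩
  obtain ⟨f, hDf, hf⟩ := hD.exists_eq_self hnil (fun r hr => hD.map_mem_lcs hr)
    (hsub (vec e (n - 2)))
  have hR : rightMul b x = rightMul b (vec e 1) := sub_eq_zero.1 ((map_sub b.flip _ _).symm.trans
    (LinearMap.mem_ker.1 hx.2))
  have hf' := he.derived_le_range hL hnil hf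
  refine ⟨D, x, f, ⟨he.chainGenerators hn hR (he.derived_le_range hL hnil hx.1) hf' ?_, hL, hD,
    hDx, hDf⟩, hR⟩
  -- `R_x³ f` has weight `4`, but lies in `L⁵` because `R_x³` kills `e_{n-2}`
  refine hD.eq_zero_of_mem_lcs hnil (m := 3) (k := 4) (by norm_num) ?_ (hD.map_pow_apply hDx hDf 3)
  obtain ⟨w, hw⟩ := hf'
  have h₀ : (rightMul b x ^ 3) (vec e (n - 2)) = 0 := by
    rw [hR, rightMul_pow_succ, rightMul_pow_succ, rightMul_pow_succ, pow_zero,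
      Module.End.one_apply, he.bracket_bracket_sub_two hn,
      he.bracket_last (by omega) le_rfl (Or.inr rfl)]
  rw [← sub_zero ((rightMul b x ^ 3) f), ← h₀, ← map_sub, ← hw, ← hR, ← Module.End.mul_apply,
    ← pow_succ]
  exact rightMul_pow_mem_lcs b x w 4

end IsFirstTypeBasis

theorem ChainGenerators.chain_ne_zero (h : ChainGenerators n b x f) (hn : 7 ≤ n)
    (hdim : Module.finrank ℂ L = n) {k : ℕ} (hk : 1 ≤ k) (hk' : k ≤ n) :
    chain n b x f k ≠ 0 := by
  obtain ⟨e, he⟩ := h.exists_basis_eq_chain hn hdim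
  exact he k hk hk' ▸ vec_ne_zero e hk hk'

theorem HomogeneousGenerators.exists_eq_of_weight (h : HomogeneousGenerators n b D x f) {m : ℕ}
    {u : L} (hu : D u = ((m : ℂ) + 1) • u) :
    ∃ s t : ℂ, u = s • (rightMul b x ^ m) x + t • (rightMul b x ^ m) f := by
  set S := Submodule.span ℂ {(rightMul b x ^ m) x, (rightMul b x ^ m) f}
  have mem_eigenspace {v : L} (hv : D v = v) (k : ℕ) :
      (rightMul b x ^ k) v ∈ Module.End.eigenspace D ((k : ℂ) + 1) :=
    Module.End.mem_eigenspace_iff.2 (h.isGradingDerivation.map_pow_apply h.map_x hv k)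
  have mem_sup {v : L} (hv : D v = v) (hvS : (rightMul b x ^ m) v ∈ S) (k : ℕ) :
      (rightMul b x ^ k) v ∈
        S ⊔ ⨆ μ : ℂ, ⨆ _ : μ ≠ (m : ℂ) + 1, Module.End.eigenspace D μ := by
    by_cases hk : k = m
    · exact Submodule.mem_sup_left (hk ▸ hvS)
    · exact Submodule.mem_sup_right (Submodule.mem_iSup_of_mem _ (Submodule.mem_iSup_of_mem
        (by simpa using hk) (mem_eigenspace hv k)))
  have hxS : (rightMul b x ^ m) x ∈ S := Submodule.subset_span (Or.inl rfl)
  have hfS : (rightMul b x ^ m) f ∈ S := Submodule.subset_span (Or.inr rfl)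
  obtain ⟨y, hy, v, hv, rfl⟩ := Submodule.mem_sup.1 ((h.eq_top_of_pow_mem
    (mem_sup h.map_x hxS) (mem_sup h.map_f hfS)).ge (Submodule.mem_top (x := u)))
  obtain ⟨s, t, rfl⟩ := Submodule.mem_span_pair.1 hy
  have hv' : v ∈ Module.End.eigenspace D ((m : ℂ) + 1) := by
    rw [← Submodule.add_mem_iff_right _ (add_mem
      (Submodule.smul_mem _ s (mem_eigenspace h.map_x m))
      (Submodule.smul_mem _ t (mem_eigenspace h.map_f m)))]
    exact Module.End.mem_eigenspace_iff.2 hu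
  obtain rfl : v = 0 := Submodule.disjoint_def.1
    (Module.End.eigenspaces_iSupIndep D ((m : ℂ) + 1)) v hv' hv
  exact ⟨s, t, add_zero _⟩

end HomogeneousGenerators

section LeftCoeffs

variable {L : Type*} [AddCommGroup L] [Module ℂ L] {b : L →ₗ[ℂ] L →ₗ[ℂ] L} {X F Y : ℕ → L}

/-- The chains `X k = R_x^k x` and `F k = R_x^k f` of two generators `x = X 0` and `f = F 0` of a
Leibniz algebra, the second chain having length `3` and the first one length at least `6`. -/
structure IsChainPair (b : L →ₗ[ℂ] L →ₗ[ℂ] L) (X F : ℕ → L) : Prop where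
  leibniz : IsLeibniz b
  gen : ∀ S : Submodule ℂ L, X 0 ∈ S → F 0 ∈ S → (∀ u ∈ S, b u (X 0) ∈ S) → S = ⊤
  X_succ : ∀ k, b (X k) (X 0) = X (k + 1)
  F_succ : ∀ k, b (F k) (X 0) = F (k + 1)
  F_three : F 3 = 0
  F_two_ne : F 2 ≠ 0
  X_ne : ∀ k ≤ 5, X k ≠ 0

/-- Structure constants of the products of a weight one vector with `F 0`, `F 1` and `F 2`. -/
structure LeftCoeffs where
  (α β μ ν π : ℂ)

/-- The left multiplication by `y` has the structure constants `A` on the chain `F`. -/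
structure HasLeftCoeffs (b : L →ₗ[ℂ] L →ₗ[ℂ] L) (X F : ℕ → L) (y : L) (A : LeftCoeffs) : Prop where
  bracket_F_zero : b y (F 0) = A.α • X 1 + A.β • F 1
  bracket_F_one : b y (F 1) = A.μ • X 2 + A.ν • F 2
  bracket_F_two : b y (F 2) = A.π • X 3

namespace IsChainPair

theorem bracket_X_succ (h : IsChainPair b X F) (u : L) (k : ℕ) : b u (X (k + 1)) = 0 :=
  h.leibniz.bracket_eq_zero_of_chain h.X_succ u k

theorem bracket_bracket_F (h : IsChainPair b X F) (u : L) (k : ℕ) :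
    b (b u (X 0)) (F k) = b (b u (F k)) (X 0) - b u (F (k + 1)) := by
  rw [h.leibniz.bracket_bracket_comm, h.F_succ]

theorem eq_zero_of_smul_X (h : IsChainPair b X F) {k : ℕ} (hk : k ≤ 5) {c : ℂ}
    (hc : c • X k = 0) : c = 0 :=
  (smul_eq_zero.1 hc).resolve_right (h.X_ne k hk)

end IsChainPair

namespace HasLeftCoeffs

variable {A : LeftCoeffs}

theorem bracket_chain_F_two (hA : HasLeftCoeffs b X F (Y 0) A) (h : IsChainPair b X F)
    (hY : ∀ k, b (Y k) (X 0) = Y (k + 1)) (k : ℕ) : b (Y k) (F 2) = A.π • X (k + 3) := by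
  induction k with
  | zero => rw [hA.bracket_F_two]
  | succ k ih =>
    rw [← hY, h.bracket_bracket_F, ih, h.F_three, map_zero, sub_zero, map_smul,
      LinearMap.smul_apply, h.X_succ]

theorem bracket_chain_F_one (hA : HasLeftCoeffs b X F (Y 0) A) (h : IsChainPair b X F)
    (hY : ∀ k, b (Y k) (X 0) = Y (k + 1)) (k : ℕ) :
    b (Y (k + 1)) (F 1) = (A.μ - (k + 1) * A.π) • X (k + 3) := by
  induction k with
  | zero =>
    rw [← hY, h.bracket_bracket_F, hA.bracket_F_one, hA.bracket_F_two, map_add, map_smul, map_smul,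
      LinearMap.add_apply, LinearMap.smul_apply, LinearMap.smul_apply, h.X_succ, h.F_succ,
      h.F_three]
    push_cast
    module
  | succ k ih =>
    rw [← hY, h.bracket_bracket_F, ih, hA.bracket_chain_F_two h hY, map_smul, LinearMap.smul_apply,
      h.X_succ]
    push_cast
    module

theorem bracket_chain_one_F_zero (hA : HasLeftCoeffs b X F (Y 0) A) (h : IsChainPair b X F)
    (hY : ∀ k, b (Y k) (X 0) = Y (k + 1)) :
    b (Y 1) (F 0) = (A.α - A.μ) • X 2 + (A.β - A.ν) • F 2 := by
  rw [← hY, h.bracket_bracket_F, hA.bracket_F_zero, hA.bracket_F_one, map_add, map_smul, map_smul,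
    LinearMap.add_apply, LinearMap.smul_apply, LinearMap.smul_apply, h.X_succ, h.F_succ]
  module

theorem bracket_chain_F_zero (hA : HasLeftCoeffs b X F (Y 0) A) (h : IsChainPair b X F)
    (hY : ∀ k, b (Y k) (X 0) = Y (k + 1)) (k : ℕ) :
    b (Y (k + 2)) (F 0) =
      (A.α - (k + 2) * A.μ + (k + 2) * (k + 1) / 2 * A.π) • X (k + 3) := by
  induction k with
  | zero =>
    rw [← hY, h.bracket_bracket_F, hA.bracket_chain_one_F_zero h hY,
      hA.bracket_chain_F_one h hY, map_add, map_smul, map_smul, LinearMap.add_apply,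
      LinearMap.smul_apply, LinearMap.smul_apply, h.X_succ, h.F_succ, h.F_three]
    push_cast
    module
  | succ k ih =>
    rw [← hY, h.bracket_bracket_F, ih, hA.bracket_chain_F_one h hY, map_smul,
      LinearMap.smul_apply, h.X_succ]
    push_cast
    module

end HasLeftCoeffs

namespace IsChainPair

variable {y : L} {A B C : LeftCoeffs}

theorem μ_eq (h : IsChainPair b X F) (hB : HasLeftCoeffs b X F (F 0) B) : B.μ = 3 * B.π := by
  have h₃ := hB.bracket_chain_F_one h h.F_succ 2
  rw [h.F_three, map_zero, LinearMap.zero_apply, eq_comm] at h₃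
  linear_combination h.eq_zero_of_smul_X le_rfl h₃

theorem α_eq (h : IsChainPair b X F) (hB : HasLeftCoeffs b X F (F 0) B) : B.α = 6 * B.π := by
  have h₃ := hB.bracket_chain_F_zero h h.F_succ 1
  rw [h.F_three, map_zero, LinearMap.zero_apply, eq_comm] at h₃
  linear_combination h.eq_zero_of_smul_X (by norm_num) h₃ + 3 * h.μ_eq hB

theorem β_smul_bracket_F_one (h : IsChainPair b X F) (hB : HasLeftCoeffs b X F (F 0) B) (u : L) :
    B.β • b u (F 1) = 0 := by
  have hff := h.leibniz u (F 0) (F 0)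
  rwa [sub_self, hB.bracket_F_zero, map_add, map_smul, map_smul, h.bracket_X_succ, smul_zero,
    zero_add] at hff

theorem β_add_one_smul_bracket_F_one (h : IsChainPair b X F) (hA : HasLeftCoeffs b X F (X 0) A)
    (u : L) : (A.β + 1) • b u (F 1) = 0 := by
  have hxf := h.leibniz u (X 0) (F 0)
  rw [hA.bracket_F_zero, h.bracket_bracket_F, map_add, map_smul, map_smul, h.bracket_X_succ] at hxf
  linear_combination (norm := module) hxf

theorem ν_add_one_smul_bracket_F_two (h : IsChainPair b X F) (hA : HasLeftCoeffs b X F (X 0) A)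
    (u : L) : (A.ν + 1) • b u (F 2) = 0 := by
  have hxF := h.leibniz u (X 0) (F 1)
  rw [hA.bracket_F_one, h.bracket_bracket_F, map_add, map_smul, map_smul, h.bracket_X_succ] at hxF
  linear_combination (norm := module) hxF

theorem bracket_bracket_F_zero_F_one (h : IsChainPair b X F) (hB : HasLeftCoeffs b X F (F 0) B)
    (u : L) : b (b u (F 0)) (F 1) = b (b u (F 1)) (F 0) + B.ν • b u (F 2) := by
  have hfF := h.leibniz u (F 0) (F 1)
  rw [hB.bracket_F_one, map_add, map_smul, map_smul, h.bracket_X_succ] at hfF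
  linear_combination (norm := module) -hfF

theorem bracket_bracket_F_zero_F_two (h : IsChainPair b X F) (hB : HasLeftCoeffs b X F (F 0) B)
    (u : L) : b (b u (F 0)) (F 2) = b (b u (F 2)) (F 0) := by
  have hfF := h.leibniz u (F 0) (F 2)
  rw [hB.bracket_F_two, map_smul, h.bracket_X_succ, smul_zero] at hfF
  exact sub_eq_zero.1 hfF.symm

theorem F_two_relation_zero (h : IsChainPair b X F) (hA : HasLeftCoeffs b X F (X 0) A)
    (hB : HasLeftCoeffs b X F (F 0) B) (hC : HasLeftCoeffs b X F y C) :
    C.α * A.π + C.β * B.π = C.π * (A.α - 3 * A.μ + 3 * A.π) := by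
  have hy := h.bracket_bracket_F_zero_F_two hB y
  simp only [hC.bracket_F_zero, hC.bracket_F_two, hA.bracket_chain_F_two h h.X_succ,
    hB.bracket_chain_F_two h h.F_succ, hA.bracket_chain_F_zero h h.X_succ 1, map_add, map_smul,
    LinearMap.add_apply, LinearMap.smul_apply] at hy
  refine sub_eq_zero.1 (h.eq_zero_of_smul_X (k := 4) (by norm_num) ?_)
  push_cast at hy
  linear_combination (norm := module) hy

theorem F_two_relation_one (h : IsChainPair b X F) (hA : HasLeftCoeffs b X F (X 0) A)
    (hB : HasLeftCoeffs b X F (F 0) B) (hC : HasLeftCoeffs b X F (Y 0) C)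
    (hY : ∀ k, b (Y k) (X 0) = Y (k + 1)) :
    (C.α - C.μ) * A.π + (C.β - C.ν) * B.π = C.π * (A.α - 4 * A.μ + 6 * A.π) := by
  have hy := h.bracket_bracket_F_zero_F_two hB (Y 1)
  simp only [hC.bracket_chain_one_F_zero h hY, hC.bracket_chain_F_two h hY,
    hA.bracket_chain_F_two h h.X_succ, hB.bracket_chain_F_two h h.F_succ,
    hA.bracket_chain_F_zero h h.X_succ 2, map_add, map_smul, LinearMap.add_apply,
    LinearMap.smul_apply] at hy
  refine sub_eq_zero.1 (h.eq_zero_of_smul_X (k := 5) le_rfl ?_)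
  push_cast at hy
  linear_combination (norm := module) hy

theorem F_one_relation_zero (h : IsChainPair b X F) (hA : HasLeftCoeffs b X F (X 0) A)
    (hB : HasLeftCoeffs b X F (F 0) B) :
    A.α * (A.μ - A.π) + A.β * (B.μ - B.π) =
      A.μ * (A.α - 2 * A.μ + A.π) + A.ν * (B.α - 2 * B.μ + B.π) + B.ν * A.π := by
  have hx := h.bracket_bracket_F_zero_F_one hB (X 0)
  simp only [hA.bracket_F_zero, hA.bracket_F_one, hA.bracket_F_two,
    hA.bracket_chain_F_one h h.X_succ 0, hB.bracket_chain_F_one h h.F_succ 0,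
    hA.bracket_chain_F_zero h h.X_succ 0, hB.bracket_chain_F_zero h h.F_succ 0, map_add, map_smul,
    LinearMap.add_apply, LinearMap.smul_apply] at hx
  refine sub_eq_zero.1 (h.eq_zero_of_smul_X (k := 3) (by norm_num) ?_)
  push_cast at hx
  linear_combination (norm := module) hx

theorem F_one_relation_one (h : IsChainPair b X F) (hA : HasLeftCoeffs b X F (X 0) A)
    (hB : HasLeftCoeffs b X F (F 0) B) :
    (A.α - A.μ) * (A.μ - 2 * A.π) + (A.β - A.ν) * (B.μ - 2 * B.π) =
      (A.μ - A.π) * (A.α - 3 * A.μ + 3 * A.π) + B.ν * A.π := by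
  have hx := h.bracket_bracket_F_zero_F_one hB (X 1)
  simp only [hA.bracket_chain_one_F_zero h h.X_succ, hA.bracket_chain_F_two h h.X_succ,
    hA.bracket_chain_F_one h h.X_succ 0, hA.bracket_chain_F_one h h.X_succ 1,
    hB.bracket_chain_F_one h h.F_succ 1, hA.bracket_chain_F_zero h h.X_succ 1, map_add, map_smul,
    LinearMap.add_apply, LinearMap.smul_apply] at hx
  refine sub_eq_zero.1 (h.eq_zero_of_smul_X (k := 4) (by norm_num) ?_)
  push_cast at hx
  linear_combination (norm := module) hx

theorem π_eq_zero (h : IsChainPair b X F) (hA : HasLeftCoeffs b X F (X 0) A)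
    (hB : HasLeftCoeffs b X F (F 0) B) (hβ : A.β = -1) (hν : A.ν = -1) (hδ : B.β = 0) :
    A.π = 0 := by
  by_contra hπ
  have hμ : A.μ = 2 * A.π := mul_left_cancel₀ hπ <| by
    linear_combination (1 / 3) * h.F_two_relation_one hA hB hA h.X_succ +
      (1 / 3) * B.π * (hν - hβ)
  have hq : B.π = 3 * A.π ^ 2 := by
    linear_combination -h.F_two_relation_zero hA hB hA + B.π * hβ + 3 * A.π * hμ
  have hq0 : B.π ≠ 0 := hq ▸ mul_ne_zero three_ne_zero (pow_ne_zero 2 hπ)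
  have hσ₁ : B.ν = 3 * A.π - A.α := mul_left_cancel₀ hπ <| by
    have hrel := h.F_one_relation_one hA hB
    rw [hβ, hν, hμ] at hrel
    linear_combination -hrel
  have hσ₂ : B.ν = 5 * A.π - A.α := mul_left_cancel₀ hq0 <| by
    have hrel := h.F_two_relation_one hA hB hB h.F_succ
    rw [h.α_eq hB, h.μ_eq hB, hδ, hμ] at hrel
    linear_combination -hrel
  exact hπ (by linear_combination (hσ₁ - hσ₂) / 2)

theorem bracket_F_two (h : IsChainPair b X F) (hA : HasLeftCoeffs b X F (X 0) A)
    (hB : HasLeftCoeffs b X F (F 0) B) (u : L) : b u (F 2) = 0 := by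
  by_contra hu
  have hν := eq_neg_of_add_eq_zero_left
    ((smul_eq_zero.1 (h.ν_add_one_smul_bracket_F_two hA u)).resolve_right hu)
  obtain ⟨v, hv⟩ : ∃ v, b v (F 1) ≠ 0 := by
    by_contra! hF
    apply hu
    rw [← h.F_succ, h.leibniz, hF, hF, map_zero, LinearMap.zero_apply, sub_zero]
  have hβ := eq_neg_of_add_eq_zero_left
    ((smul_eq_zero.1 (h.β_add_one_smul_bracket_F_one hA v)).resolve_right hv)
  have hδ := (smul_eq_zero.1 (h.β_smul_bracket_F_one hB v)).resolve_right hv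
  have hπ := h.π_eq_zero hA hB hβ hν hδ
  have hq : B.π = 0 := by
    linear_combination -h.F_two_relation_zero hA hB hA + B.π * hβ +
      (A.α - (A.α - 3 * A.μ + 3 * A.π)) * hπ
  have hker : LinearMap.ker (rightMul b (F 2)) = ⊤ := by
    refine h.gen _ ?_ ?_ fun w hw => ?_
    · rw [LinearMap.mem_ker, rightMul_apply, hA.bracket_F_two, hπ, zero_smul]
    · rw [LinearMap.mem_ker, rightMul_apply, hB.bracket_F_two, hq, zero_smul]
    · rw [LinearMap.mem_ker, rightMul_apply] at hw ⊢
      rw [h.bracket_bracket_F, hw, h.F_three, map_zero, map_zero, LinearMap.zero_apply, sub_zero]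
  exact hu (LinearMap.mem_ker.1 (hker.ge (Submodule.mem_top (x := u))))

theorem π_eq_zero_of_hasLeftCoeffs (h : IsChainPair b X F) (hA : HasLeftCoeffs b X F (X 0) A)
    (hB : HasLeftCoeffs b X F (F 0) B) (hC : HasLeftCoeffs b X F y C) : C.π = 0 :=
  h.eq_zero_of_smul_X (k := 3) (by norm_num) (hC.bracket_F_two ▸ h.bracket_F_two hA hB y)

theorem μ_eq_zero (h : IsChainPair b X F) (hA : HasLeftCoeffs b X F (X 0) A)
    (hB : HasLeftCoeffs b X F (F 0) B) : A.μ = 0 := by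
  have hrel := h.F_one_relation_zero hA hB
  rw [h.α_eq hB, h.μ_eq hB, h.π_eq_zero_of_hasLeftCoeffs hA hB hA,
    h.π_eq_zero_of_hasLeftCoeffs hA hB hB] at hrel
  exact pow_eq_zero_iff two_ne_zero |>.1 (by linear_combination hrel / 2)

theorem bracket_F_zero_F_zero (h : IsChainPair b X F) (hA : HasLeftCoeffs b X F (X 0) A)
    (hB : HasLeftCoeffs b X F (F 0) B) : b (F 0) (F 0) = B.β • F 1 := by
  rw [hB.bracket_F_zero, h.α_eq hB, h.π_eq_zero_of_hasLeftCoeffs hA hB hB, mul_zero, zero_smul,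
    zero_add]

theorem bracket_X_zero_F_one (h : IsChainPair b X F) (hA : HasLeftCoeffs b X F (X 0) A)
    (hB : HasLeftCoeffs b X F (F 0) B) : b (X 0) (F 1) = A.ν • F 2 := by
  rw [hA.bracket_F_one, h.μ_eq_zero hA hB, zero_smul, zero_add]

theorem bracket_F_zero_F_one (h : IsChainPair b X F) (hA : HasLeftCoeffs b X F (X 0) A)
    (hB : HasLeftCoeffs b X F (F 0) B) : b (F 0) (F 1) = B.ν • F 2 := by
  rw [hB.bracket_F_one, h.μ_eq hB, h.π_eq_zero_of_hasLeftCoeffs hA hB hB, mul_zero, zero_smul,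
    zero_add]

theorem good (h : IsChainPair b X F) (hA : HasLeftCoeffs b X F (X 0) A)
    (hB : HasLeftCoeffs b X F (F 0) B) : Params.Good ⟨A.α, A.β, B.β, A.ν, B.ν⟩ := by
  have eq_zero {c d : ℂ} (hc : c • d • F 2 = 0) : c * d = 0 :=
    (smul_eq_zero.1 (smul_smul c d (F 2) ▸ hc)).resolve_right h.F_two_ne
  have hx := h.bracket_X_zero_F_one hA hB
  have hf := h.bracket_F_zero_F_one hA hB
  exact ⟨eq_zero (hx ▸ h.β_smul_bracket_F_one hB _), eq_zero (hf ▸ h.β_smul_bracket_F_one hB _),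
    eq_zero (hx ▸ h.β_add_one_smul_bracket_F_one hA _),
    eq_zero (hf ▸ h.β_add_one_smul_bracket_F_one hA _)⟩

end IsChainPair

end LeftCoeffs

section Structure

variable {L : Type*} [AddCommGroup L] [Module ℂ L] {n : ℕ} {b : L →ₗ[ℂ] L →ₗ[ℂ] L}
  {D : L →ₗ[ℂ] L} {x f : L}

namespace HomogeneousGenerators

theorem isChainPair (h : HomogeneousGenerators n b D x f) (hn : 9 ≤ n)
    (hdim : Module.finrank ℂ L = n) :
    IsChainPair b (fun k => (rightMul b x ^ k) x) fun k => (rightMul b x ^ k) f where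
  leibniz := h.leibniz
  gen := h.gen
  X_succ k := (rightMul_pow_succ b x x k).symm
  F_succ k := (rightMul_pow_succ b x f k).symm
  F_three := h.pow_f
  F_two_ne := chain_self (b := b) (x := x) (f := f) (show 7 ≤ n by omega) ▸
    h.chain_ne_zero (by omega) hdim (by omega) le_rfl
  X_ne k hk := by
    have hne := h.chain_ne_zero (by omega) hdim (k := k + 1) (by omega) (by omega)
    rwa [chain_of_le (by omega)] at hne

theorem exists_hasLeftCoeffs (h : HomogeneousGenerators n b D x f) {y : L} (hy : D y = y) :
    ∃ A, HasLeftCoeffs b (fun k => (rightMul b x ^ k) x) (fun k => (rightMul b x ^ k) f) y A := by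
  have hweight (k : ℕ) : D (b y ((rightMul b x ^ k) f)) =
      (((k + 1 : ℕ) : ℂ) + 1) • b y ((rightMul b x ^ k) f) := by
    rw [h.isGradingDerivation.leibniz_rule, hy,
      h.isGradingDerivation.map_pow_apply h.map_x h.map_f, map_smul]
    push_cast
    module
  obtain ⟨α, β, h₀⟩ := h.exists_eq_of_weight (hweight 0)
  obtain ⟨μ, ν, h₁⟩ := h.exists_eq_of_weight (hweight 1)
  obtain ⟨π, t, h₂⟩ := h.exists_eq_of_weight (hweight 2)
  rw [h.pow_f, smul_zero, add_zero] at h₂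
  exact ⟨⟨α, β, μ, ν, π⟩, h₀, h₁, h₂⟩

theorem exists_presentation (h : HomogeneousGenerators n b D x f) (hn : 9 ≤ n)
    (hdim : Module.finrank ℂ L = n) : ∃ P : Params, P.Good ∧ Presentation n b x f P := by
  obtain ⟨A, hA⟩ := h.exists_hasLeftCoeffs h.map_x
  obtain ⟨B, hB⟩ := h.exists_hasLeftCoeffs h.map_f
  have hc := h.isChainPair hn hdim
  exact ⟨_, hc.good hA hB, h.toChainGenerators, h.leibniz, hA.bracket_F_zero,
    hc.bracket_F_zero_F_zero hA hB, hc.bracket_X_zero_F_one hA hB, hc.bracket_F_zero_F_one hA hB,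
    hc.bracket_F_two hA hB⟩

end HomogeneousGenerators

theorem Presentation.bracket_bracket_bracket_x_x {P : Params} (h : Presentation n b x f P)
    (u v : L) : b v (b (b u x) x) = 0 := by
  have hker : LinearMap.ker (b v ∘ₗ rightMul b x ^ 2) = ⊤ := by
    refine h.eq_top_of_pow_mem (fun k => ?_) fun k => ?_ <;>
      rw [LinearMap.mem_ker, LinearMap.comp_apply,
        ← Module.End.mul_apply (rightMul b x ^ 2), ← pow_add, add_comm]
    · exact h.leibniz.bracket_pow_succ v x (k + 1)
    · cases k with
      | zero => exact h.bracket_f₃ v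
      | succ k => rw [h.pow_f_of_le (by omega), map_zero]
  exact LinearMap.mem_ker.1 (hker.ge (Submodule.mem_top (x := u)))

end Structure

end NatGradedLeibniz

end

theorem theorem2p2 (n : ℕ) (hn : 9 ≤ n) :
    -- every algebra of the first type is isomorphic to a listed one, and in every basis
    -- of the first type the last vector lies in the right annihilator
    (∀ (L : Type*) [AddCommGroup L] [Module ℂ L] (b : L →ₗ[ℂ] L →ₗ[ℂ] L),
      Module.finrank ℂ L = n → IsFirstType n b →
        (∃ p : Label, p.Admissible ∧ Isomorphic b (p.algebra n)) ∧
        ∀ e : Module.Basis (Fin n) ℂ L, IsFirstTypeBasis b e →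
          vec e n ∈ rightAnnihilator b) ∧
    -- every listed algebra is of the first type
    (∀ p : Label, p.Admissible → IsFirstType n (p.algebra n)) ∧
    -- the listed algebras are pairwise non-isomorphic
    (∀ p q : Label, p.Admissible → q.Admissible →
      Isomorphic (p.algebra n) (q.algebra n) → p = q) := by
  refine ⟨fun L _ _ b hdim hb => ?_, fun p _ => ?_, fun p q hp hq h => ?_⟩
  · obtain ⟨hng, -, e₀, he₀⟩ := hb
    refine ⟨?_, fun e he => ?_⟩
    · obtain ⟨D, x, f, hxf, -⟩ := he₀.exists_homogeneousGenerators (by omega) hng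
      obtain ⟨Q, hQ, hpres⟩ := hxf.exists_presentation hn hdim
      obtain ⟨p, hp, s, d, hrel⟩ := hQ.normalizes
      obtain ⟨e, he⟩ := (hpres.change_generators (by omega) hdim hrel).exists_isStandardBasis
        (by omega) hdim
      exact ⟨p, hp, he.isomorphic (p.isStandardBasis (by omega))⟩
    · obtain ⟨D, x, f, hxf, hx⟩ := he.exists_homogeneousGenerators (by omega) hng
      obtain ⟨Q, -, hpres⟩ := hxf.exists_presentation hn hdim
      have hlast : b (b (vec e (n - 2)) x) x = vec e n := by
        rw [← he.bracket_bracket_sub_two (by omega), ← rightMul_apply, ← rightMul_apply, hx]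
        rfl
      exact fun y => hlast ▸ hpres.bracket_bracket_bracket_x_x _ y
  · exact (p.isStandardBasis (by omega)).isFirstType (by omega) p.good_params
  · obtain ⟨φ, hφ⟩ := h
    obtain ⟨s, d, hrel⟩ := (q.isStandardBasis (by omega)).exists_related
      ((p.isStandardBasis (by omega)).map hφ) (by omega)
    exact Label.eq_of_related hp hq hrel
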